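/- **Setting.** The $\lambda\Pi$-calculus modulo rewriting ($\lambda\Pi/\mathcal R$) has objects $M,N ::= c \mid x \mid \lambda x{:}A.\,M \mid M\,N$, types $A,B ::= a \mid \Pi x{:}A.\,B \mid \lambda x{:}A.\,B \mid A\,M$ and kinds $K ::= \mathsf{Type} \mid \Pi x{:}A.\,K$ (up to $\alpha$-equality). A theory is a finite sequence of declarations $c:A$, $a:K$ and rewrite rules $M\hookrightarrow N$, $A\hookrightarrow B$. It is well formed if each constant is declared only once, with a type (kind) that is well formed in the empty context over the preceding entries, and each rule $\ell\hookrightarrow r$ satisfies, over the preceding entries: $\ell$ is a constant applied to algebraic arguments (terms built from variables and applied constants), the free variables of $r$ are free in $\ell$, and $\Gamma\vdash\ell\theta:U$ implies $\Gamma\vdash r\theta:U$ for all substitutions $\theta$. Typing is given by the usual rules of LF with untyped conversion $\equiv$: the least equivalence relation on raw terms that is closed under term constructors and substitutions and contains $\beta$, the rewrite rules of the theory and, in the variant with $\eta$, also $\eta$. Either variant (with or without $\eta$) may be fixed globally. All theories below are well formed. A *theory morphism* $\mu$ from $\mathbb S$ to $\mathbb T$ is the homomorphic extension of an assignment of closed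 $\mathbb T$-terms $\mu_c,\mu_a$ to the constants of $\mathbb S$ such that $\vdash_{\mathbb T}\mu_c:\mu(A)$ for each $c:A$ in $\mathbb S$, $\vdash_{\mathbb T}\mu_a:\mu(K)$ for each $a:K$ in $\mathbb S$, and $\mu(\ell)\equiv\mu(r)$ in $\mathbb T$ for each rule $\ell\hookrightarrow r$ of $\mathbb S$. Let $\mu_1,\dots,\mu_n$ be theory morphisms from $\mathbb S$ to $\mathbb T$, where $\mu_i$ also renames each variable $x$ to $x_i$. Write $\vec\mu(t)$ for $\mu_1(t),\dots,\mu_n(t)$; write $\lambda\vec x:\vec\mu(A).\,t$ for $\lambda x_1{:}\mu_1(A).\cdots\lambda x_n{:}\mu_n(A).\,t$ and similarly for $\Pi$ and for contexts; $t\,\vec M$ is iterated application and $\vec\mu(A)\to t$ the iterated non-dependent product. Given closed $\mathbb T$-terms $\lambda^*_c,\lambda^*_a$ for the constants of $\mathbb S$, define $$\begin{aligned} \lambda^*(x)&=x^*,\qquad \lambda^*(c)=\lambda^*_c,\qquad \lambda^*(a)=\lambda^*_a,\\ \lambda^*(t\,N)&=\lambda^*(t)\,\vec\mu(N)\,\lambda^*(N)\quad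 (t\text{ an object or a type}),\\ \lambda^*(\lambda x{:}A.\,t)&=\lambda\vec x:\vec\mu(A).\ \lambda x^*:\lambda^*(A)\,\vec x.\ \lambda^*(t)\quad (t\text{ an object or a type}),\\ \lambda^*(\Pi x{:}A.\,B)&=\lambda\vec f:\vec\mu(\Pi x{:}A.\,B).\ \Pi\vec x:\vec\mu(A).\ \Pi x^*:\lambda^*(A)\,\vec x.\ \lambda^*(B)\,(f_1\,x_1)\cdots(f_n\,x_n),\\ \lambda^{*R}(\Pi x{:}A.\,K)&=\Pi\vec x:\vec\mu(A).\ \Pi x^*:\lambda^*(A)\,\vec x.\ \lambda^{*\,R\,x}(K),\qquad \lambda^{*R}(\mathsf{Type})=\vec\mu(R)\to\mathsf{Type},\\ \lambda^*(\varnothing)&=\varnothing,\qquad \lambda^*(\Gamma,x{:}A)=\lambda^*(\Gamma),\ \vec x:\vec\mu(A),\ x^*:\lambda^*(A)\,\vec x . \end{aligned}$$ The mapping $\lambda^*$ is an *($n$-ary) logical relation* on $\mu_1,\dots,\mu_n$ if $\vdash_{\mathbb T}\lambda^*_c:\lambda^*(A)\,\vec\mu(c)$ for each $c:A$ in $\mathbb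 S$, $\vdash_{\mathbb T}\lambda^*_a:\lambda^{*a}(K)$ for each $a:K$ in $\mathbb S$, and $\lambda^*(\ell)\equiv\lambda^*(r)$ in $\mathbb T$ for each rewrite rule $\ell\hookrightarrow r$ of $\mathbb S$. **Theorem (Abstraction).** Let $\lambda^*$ be a logical relation on $\mu_1,\dots,\mu_n$. Then: 1. If $\vdash_{\mathbb S}\Gamma$, then $\vdash_{\mathbb T}\lambda^*(\Gamma)$. 2. If $\Gamma\vdash_{\mathbb S}M:A$ and $\Gamma\vdash_{\mathbb S}A:\mathsf{Type}$, then $\lambda^*(\Gamma)\vdash_{\mathbb T}\lambda^*(M):\lambda^*(A)\,\vec\mu(M)$. 3. If $\Gamma\vdash_{\mathbb S}A:K$ and $\Gamma\vdash_{\mathbb S}K:\mathsf{Kind}$, then $\lambda^*(\Gamma)\vdash_{\mathbb T}\lambda^*(A):\lambda^{*A}(K)$. 4. If $\Gamma\vdash_{\mathbb S}K:\mathsf{Kind}$ and $\Gamma\vdash_{\mathbb S}A:K$, then $\lambda^*(\Gamma)\vdash_{\mathbb T}\lambda^{*A}(K):\mathsf{Kind}$. -/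

import Mathlib

/-!
# The lambda-Pi-calculus modulo rewriting, theory morphisms and logical relations

Terms are quotiented by renaming of bound variables: variables are de Bruijn indices, index `0`
being the innermost (most recently declared) variable.
-/

namespace LPR

/-- The two levels at which constants, abstractions and applications live:
objects and types (type families). -/
inductive Lvl : Type
  | obj
  | ty

universe u v

/-- Raw objects (`Tm C .obj`) and raw types (`Tm C .ty`), where `C .obj` is the set of names of
object constants and `C .ty` the set of names of type constants. -/
inductive Tm (C : Lvl → Type u) : Lvl → Type u
  /-- a constant: `c` or `a` -/
  | cst {l : Lvl} (c : C l) : Tm C l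
  /-- a variable (object variables only) -/
  | var (i : ℕ) : Tm C .obj
  /-- `λ x : A. M` and `λ x : A. B` -/
  | lam {l : Lvl} (A : Tm C .ty) (t : Tm C l) : Tm C l
  /-- `M N` and `A N` -/
  | app {l : Lvl} (t : Tm C l) (N : Tm C .obj) : Tm C l
  /-- `Π x : A. B` -/
  | pi (A B : Tm C .ty) : Tm C .ty

/-- Raw kinds. -/
inductive Kd (C : Lvl → Type u) : Type u
  /-- the kind `Type` -/
  | type : Kd C
  /-- `Π x : A. K` -/
  | pi (A : Tm C .ty) (K : Kd C) : Kd C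

/-- Raw contexts; the most recently declared variable comes first, so `Γ, x : A` is `A :: Γ`.
Each type lives in the context formed by the rest of the list. -/
abbrev Ctx (C : Lvl → Type u) : Type u := List (Tm C .ty)

section Substitution

variable {C : Lvl → Type u}

/-- A renaming pushed under one binder. -/
def liftRen (f : ℕ → ℕ) : ℕ → ℕ
  | 0 => 0
  | k + 1 => f k + 1

/-- Renaming of the free variables. -/
def Tm.rename : {l : Lvl} → (ℕ → ℕ) → Tm C l → Tm C l
  | _, _, .cst c => .cst c
  | _, f, .var i => .var (f i)
  | _, f, .lam A t => .lam (A.rename f) (t.rename (liftRen f))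
  | _, f, .app t N => .app (t.rename f) (N.rename f)
  | _, f, .pi A B => .pi (A.rename f) (B.rename (liftRen f))

/-- Weakening by `k` variables. -/
def Tm.shift {l : Lvl} (k : ℕ) (t : Tm C l) : Tm C l := t.rename (fun i => i + k)

/-- A substitution pushed under one binder. -/
def up (σ : ℕ → Tm C .obj) : ℕ → Tm C .obj
  | 0 => .var 0
  | k + 1 => (σ k).shift 1

/-- Simultaneous capture-avoiding substitution. -/
def Tm.subst : {l : Lvl} → (ℕ → Tm C .obj) → Tm C l → Tm C l
  | _, _, .cst c => .cst c
  | _, σ, .var i => σ i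
  | _, σ, .lam A t => .lam (A.subst σ) (t.subst (up σ))
  | _, σ, .app t N => .app (t.subst σ) (N.subst σ)
  | _, σ, .pi A B => .pi (A.subst σ) (B.subst (up σ))

/-- Substitution in kinds. -/
def Kd.subst : (ℕ → Tm C .obj) → Kd C → Kd C
  | _, .type => .type
  | σ, .pi A K => .pi (A.subst σ) (K.subst (up σ))

/-- The substitution `[x ← N]` for the innermost variable `x`. -/
def single (N : Tm C .obj) : ℕ → Tm C .obj
  | 0 => N
  | k + 1 => .var k

/-- `t[x ← N]` -/
def Tm.inst {l : Lvl} (t : Tm C l) (N : Tm C .obj) : Tm C l := t.subst (single N)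

/-- `K[x ← N]` -/
def Kd.inst (K : Kd C) (N : Tm C .obj) : Kd C := K.subst (single N)

/-- The variable `i` occurs free in the term. -/
def Tm.Free : {l : Lvl} → Tm C l → ℕ → Prop
  | _, .cst _, _ => False
  | _, .var j, i => i = j
  | _, .lam A t, i => A.Free i ∨ t.Free (i + 1)
  | _, .app t N, i => t.Free i ∨ N.Free i
  | _, .pi A B, i => A.Free i ∨ B.Free (i + 1)

/-- Algebraic terms that are not variables: a constant applied to arguments, each of which is
a variable or again such a term. -/
inductive Tm.Pattern : {l : Lvl} → Tm C l → Prop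
  | cst {l : Lvl} (c : C l) : Tm.Pattern (.cst c)
  | app_var {l : Lvl} {t : Tm C l} (i : ℕ) : t.Pattern → Tm.Pattern (.app t (.var i))
  | app {l : Lvl} {t : Tm C l} {N : Tm C .obj} :
      t.Pattern → N.Pattern → Tm.Pattern (.app t N)

end Substitution

/-- An entry of a theory: `c : A`, `a : K`, or a rewrite rule between two objects or between
two types. -/
inductive Decl (C : Lvl → Type u) : Type u
  | obj (c : C .obj) (A : Tm C .ty) : Decl C
  | ty (a : C .ty) (K : Kd C) : Decl C
  | rule {l : Lvl} (lhs rhs : Tm C l) : Decl C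

/-- Raw theories: finite sequences of entries, the most recent entry first. -/
abbrev Theory (C : Lvl → Type u) : Type u := List (Decl C)

section Typing

variable {C : Lvl → Type u}

/-- The constant is declared in the theory. -/
inductive Theory.Dom (T : Theory C) : {l : Lvl} → C l → Prop
  | obj {c : C .obj} {A : Tm C .ty} : Decl.obj c A ∈ T → Theory.Dom T c
  | ty {a : C .ty} {K : Kd C} : Decl.ty a K ∈ T → Theory.Dom T a

/-- All constants of the term are declared in the theory. -/
def Tm.Over (T : Theory C) : {l : Lvl} → Tm C l → Prop
  | _, .cst c => Theory.Dom T c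
  | _, .var _ => True
  | _, .lam A t => A.Over T ∧ t.Over T
  | _, .app t N => t.Over T ∧ N.Over T
  | _, .pi A B => A.Over T ∧ B.Over T

/-- One-step reduction on objects and on types: the closure under term constructors of the
substitution instances of beta-reduction, of the rewrite rules of `T` and, if the flag `η` is
`true`, of eta-expansion. -/
inductive Step (η : Bool) (T : Theory C) : {l : Lvl} → Tm C l → Tm C l → Prop
  | beta {l : Lvl} (A : Tm C .ty) (t : Tm C l) (N : Tm C .obj) :
      Step η T (.app (.lam A t) N) (t.inst N)
  | eta {l : Lvl} (hη : η = true) (A : Tm C .ty) (t : Tm C l) :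
      Step η T t (.lam A (.app (t.shift 1) (.var 0)))
  | rule {l : Lvl} {lhs rhs : Tm C l} (h : Decl.rule lhs rhs ∈ T) (σ : ℕ → Tm C .obj) :
      Step η T (lhs.subst σ) (rhs.subst σ)
  | lam_left {l : Lvl} {A A' : Tm C .ty} {t : Tm C l} :
      Step η T A A' → Step η T (.lam A t) (.lam A' t)
  | lam_right {l : Lvl} {A : Tm C .ty} {t t' : Tm C l} :
      Step η T t t' → Step η T (.lam A t) (.lam A t')
  | app_left {l : Lvl} {t t' : Tm C l} {N : Tm C .obj} :
      Step η T t t' → Step η T (.app t N) (.app t' N)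
  | app_right {l : Lvl} {t : Tm C l} {N N' : Tm C .obj} :
      Step η T N N' → Step η T (.app t N) (.app t N')
  | pi_left {A A' B : Tm C .ty} : Step η T A A' → Step η T (.pi A B) (.pi A' B)
  | pi_right {A B B' : Tm C .ty} : Step η T B B' → Step η T (.pi A B) (.pi A B')

/-- One-step reduction on kinds. -/
inductive StepK (η : Bool) (T : Theory C) : Kd C → Kd C → Prop
  | pi_left {A A' : Tm C .ty} {K : Kd C} : Step η T A A' → StepK η T (.pi A K) (.pi A' K)
  | pi_right {A : Tm C .ty} {K K' : Kd C} : StepK η T K K' → StepK η T (.pi A K) (.pi A K')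

/-- Conversion of objects and of types (untyped): the reflexive, symmetric and transitive
closure of reduction. -/
def Conv (η : Bool) (T : Theory C) {l : Lvl} : Tm C l → Tm C l → Prop :=
  Relation.EqvGen (Step η T)

/-- Conversion of kinds. -/
def ConvK (η : Bool) (T : Theory C) : Kd C → Kd C → Prop :=
  Relation.EqvGen (StepK η T)

/-- The four forms of judgments relative to a theory. -/
inductive Judg (C : Lvl → Type u) : Type u
  /-- `⊢ Γ` -/
  | ctx (Γ : Ctx C) : Judg C
  /-- `Γ ⊢ M : A` -/
  | obj (Γ : Ctx C) (M : Tm C .obj) (A : Tm C .ty) : Judg C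
  /-- `Γ ⊢ A : K` -/
  | ty (Γ : Ctx C) (A : Tm C .ty) (K : Kd C) : Judg C
  /-- `Γ ⊢ K : Kind` -/
  | kind (Γ : Ctx C) (K : Kd C) : Judg C

/-- Derivability of judgments in the theory `T`. -/
inductive Derives (η : Bool) (T : Theory C) : Judg C → Prop
  -- contexts
  | empty : Derives η T (.ctx [])
  | decl {Γ : Ctx C} {A : Tm C .ty} :
      Derives η T (.ctx Γ) → Derives η T (.ty Γ A .type) → Derives η T (.ctx (A :: Γ))
  -- objects
  | const_obj {Γ : Ctx C} {c : C .obj} {A : Tm C .ty} :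
      Decl.obj c A ∈ T → Derives η T (.ctx Γ) → Derives η T (.obj Γ (.cst c) A)
  | var {Γ : Ctx C} {i : ℕ} {A : Tm C .ty} :
      Γ[i]? = some A → Derives η T (.ctx Γ) → Derives η T (.obj Γ (.var i) (A.shift (i + 1)))
  | abs_obj {Γ : Ctx C} {A B : Tm C .ty} {M : Tm C .obj} :
      Derives η T (.ty Γ A .type) → Derives η T (.ty (A :: Γ) B .type) →
      Derives η T (.obj (A :: Γ) M B) → Derives η T (.obj Γ (.lam A M) (.pi A B))
  | app_obj {Γ : Ctx C} {A B : Tm C .ty} {M N : Tm C .obj} :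
      Derives η T (.obj Γ M (.pi A B)) → Derives η T (.obj Γ N A) →
      Derives η T (.obj Γ (.app M N) (B.inst N))
  | conv_type {Γ : Ctx C} {A B : Tm C .ty} {M : Tm C .obj} :
      Conv η T A B → Derives η T (.obj Γ M A) → Derives η T (.ty Γ B .type) →
      Derives η T (.obj Γ M B)
  -- types
  | const_type {Γ : Ctx C} {a : C .ty} {K : Kd C} :
      Decl.ty a K ∈ T → Derives η T (.ctx Γ) → Derives η T (.ty Γ (.cst a) K)
  | prod_type {Γ : Ctx C} {A B : Tm C .ty} :
      Derives η T (.ty Γ A .type) → Derives η T (.ty (A :: Γ) B .type) →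
      Derives η T (.ty Γ (.pi A B) .type)
  | abs_type {Γ : Ctx C} {A B : Tm C .ty} {K : Kd C} :
      Derives η T (.ty Γ A .type) → Derives η T (.kind (A :: Γ) K) →
      Derives η T (.ty (A :: Γ) B K) → Derives η T (.ty Γ (.lam A B) (.pi A K))
  | app_type {Γ : Ctx C} {A B : Tm C .ty} {K : Kd C} {M : Tm C .obj} :
      Derives η T (.ty Γ A (.pi B K)) → Derives η T (.obj Γ M B) →
      Derives η T (.ty Γ (.app A M) (K.inst M))
  | conv_kind {Γ : Ctx C} {A : Tm C .ty} {K K' : Kd C} :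
      ConvK η T K K' → Derives η T (.ty Γ A K) → Derives η T (.kind Γ K') →
      Derives η T (.ty Γ A K')
  -- kinds
  | sort {Γ : Ctx C} : Derives η T (.ctx Γ) → Derives η T (.kind Γ .type)
  | prod_kind {Γ : Ctx C} {A : Tm C .ty} {K : Kd C} :
      Derives η T (.ty Γ A .type) → Derives η T (.kind (A :: Γ) K) →
      Derives η T (.kind Γ (.pi A K))

/-- `⊢ Γ` in `T` -/
abbrev WfCtx (η : Bool) (T : Theory C) (Γ : Ctx C) : Prop := Derives η T (.ctx Γ)

/-- `Γ ⊢ M : A` in `T` -/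
abbrev HasType (η : Bool) (T : Theory C) (Γ : Ctx C) (M : Tm C .obj) (A : Tm C .ty) : Prop :=
  Derives η T (.obj Γ M A)

/-- `Γ ⊢ A : K` in `T` -/
abbrev HasKind (η : Bool) (T : Theory C) (Γ : Ctx C) (A : Tm C .ty) (K : Kd C) : Prop :=
  Derives η T (.ty Γ A K)

/-- `Γ ⊢ K : Kind` in `T` -/
abbrev WfKind (η : Bool) (T : Theory C) (Γ : Ctx C) (K : Kd C) : Prop :=
  Derives η T (.kind Γ K)

/-- The rule `lhs ↪ rhs` preserves typing: every type (or kind) of an instance of the left-hand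
side is one of the corresponding instance of the right-hand side. -/
def PreservesTyping (η : Bool) (T : Theory C) : {l : Lvl} → Tm C l → Tm C l → Prop
  | .obj, lhs, rhs => ∀ (Γ : Ctx C) (σ : ℕ → Tm C .obj) (A : Tm C .ty),
      HasType η T Γ (lhs.subst σ) A → HasType η T Γ (rhs.subst σ) A
  | .ty, lhs, rhs => ∀ (Γ : Ctx C) (σ : ℕ → Tm C .obj) (K : Kd C),
      HasKind η T Γ (lhs.subst σ) K → HasKind η T Γ (rhs.subst σ) K

/-- Well-formed rewrite rules between terms over the theory `T`. -/
structure WfRule (η : Bool) (T : Theory C) {l : Lvl} (lhs rhs : Tm C l) : Prop where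
  over_lhs : lhs.Over T
  over_rhs : rhs.Over T
  pattern : lhs.Pattern
  free : ∀ i, rhs.Free i → lhs.Free i
  preserves : PreservesTyping η T lhs rhs

/-- Well-formed theories. -/
inductive Theory.Wf (η : Bool) : Theory C → Prop
  | empty : Theory.Wf η []
  | decl_obj {T : Theory C} {c : C .obj} {A : Tm C .ty} :
      ¬ Theory.Dom T c → Theory.Wf η T → HasKind η T [] A .type →
      Theory.Wf η (Decl.obj c A :: T)
  | decl_type {T : Theory C} {a : C .ty} {K : Kd C} :
      ¬ Theory.Dom T a → Theory.Wf η T → WfKind η T [] K → Theory.Wf η (Decl.ty a K :: T)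
  | rewr {T : Theory C} {l : Lvl} {lhs rhs : Tm C l} :
      Theory.Wf η T → WfRule η T lhs rhs → Theory.Wf η (Decl.rule lhs rhs :: T)

end Typing

section Morphisms

variable {C : Lvl → Type u} {C' : Lvl → Type v}

/-- A set of parameters: to every source constant, a closed target term of the same level.
(A term that is typable in the empty context is closed, so closedness only restricts the
irrelevant values at names that the source theory does not declare.) -/
structure Params (C : Lvl → Type u) (C' : Lvl → Type v) where
  val : {l : Lvl} → C l → Tm C' l
  closed : ∀ {l : Lvl} (c : C l) (σ : ℕ → Tm C' .obj), (val c).subst σ = val c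

/-- The homomorphic extension of parameters to objects and types. -/
def Params.tm (m : Params C C') : {l : Lvl} → Tm C l → Tm C' l
  | _, .cst c => m.val c
  | _, .var i => .var i
  | _, .lam A t => .lam (m.tm A) (m.tm t)
  | _, .app t N => .app (m.tm t) (m.tm N)
  | _, .pi A B => .pi (m.tm A) (m.tm B)

/-- The homomorphic extension of parameters to kinds. -/
def Params.kd (m : Params C C') : Kd C → Kd C'
  | .type => .type
  | .pi A K => .pi (m.tm A) (m.kd K)

/-- The parameters `m` form a theory morphism from `S` to `T`. -/
structure IsMorphism (η : Bool) (S : Theory C) (T : Theory C') (m : Params C C') : Prop where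
  obj : ∀ (c : C .obj) (A : Tm C .ty), Decl.obj c A ∈ S → HasType η T [] (m.val c) (m.tm A)
  ty : ∀ (a : C .ty) (K : Kd C), Decl.ty a K ∈ S → HasKind η T [] (m.val a) (m.kd K)
  rule : ∀ {l : Lvl} (lhs rhs : Tm C l), Decl.rule lhs rhs ∈ S →
    Conv η T (m.tm lhs) (m.tm rhs)

end Morphisms

section Telescopes

variable {C : Lvl → Type u}

/-- `t N₁ … Nₙ` -/
def apps {l : Lvl} (t : Tm C l) (Ns : List (Tm C .obj)) : Tm C l := Ns.foldl .app t

/-- `lams 0 [A₁, …, Aₙ] t` is `λ x₁ : A₁. … λ xₙ : Aₙ. t`, where all the `Aᵢ` live outside of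
the new binders (and `t` inside). The first argument counts the binders already crossed. -/
def lams {l : Lvl} : ℕ → List (Tm C .ty) → Tm C l → Tm C l
  | _, [], t => t
  | k, A :: As, t => .lam (A.shift k) (lams (k + 1) As t)

/-- `Π x₁ : A₁. … Π xₙ : Aₙ. B`, same conventions. -/
def pis : ℕ → List (Tm C .ty) → Tm C .ty → Tm C .ty
  | _, [], B => B
  | k, A :: As, B => .pi (A.shift k) (pis (k + 1) As B)

/-- `Π x₁ : A₁. … Π xₙ : Aₙ. K`, same conventions. -/
def pisK : ℕ → List (Tm C .ty) → Kd C → Kd C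
  | _, [], K => K
  | k, A :: As, K => .pi (A.shift k) (pisK (k + 1) As K)

/-- `Γ, x₁ : A₁, …, xₙ : Aₙ`, where all the `Aᵢ` live in `Γ`; same conventions. -/
def extend : ℕ → List (Tm C .ty) → Ctx C → Ctx C
  | _, [], Γ => Γ
  | k, A :: As, Γ => extend (k + 1) As (A.shift k :: Γ)

/-- The variables `x₁, …, xₙ` just after they have been bound in this order. -/
def vars (n : ℕ) : List (Tm C .obj) := List.ofFn fun i : Fin n => .var (n - 1 - i)

end Telescopes

section LogicalRelations

variable {C : Lvl → Type u} {C' : Lvl → Type v} {n : ℕ}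

/-- `μᵢ(t)` with every free variable `x` renamed to `xᵢ`. In translated contexts every source
variable `x` becomes a block `x₁, …, xₙ, x*` declared in this order, so the source index `k`
becomes `k (n + 1)` for `x*` and `k (n + 1) + (n - i)` for the `i`-th copy (`i` from `0`). -/
def copy (μ : Fin n → Params C C') (i : Fin n) {l : Lvl} (t : Tm C l) : Tm C' l :=
  ((μ i).tm t).rename fun k => k * (n + 1) + (n - i)

/-- The list `μ₁(t), …, μₙ(t)`. -/
def copies (μ : Fin n → Params C C') {l : Lvl} (t : Tm C l) : List (Tm C' l) :=
  List.ofFn fun i => copy μ i t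

/-- The mapping `λ*` on objects and types that is induced by the parameters `ρ`, with respect
to `μ₁, …, μₙ`. In the case of `Π x : A. B` the body lives under the binders
`f₁, …, fₙ, x₁, …, xₙ, x*`; the renaming of `λ*(B)` makes room for the `fᵢ`. -/
def rel (μ : Fin n → Params C C') (ρ : Params C C') : {l : Lvl} → Tm C l → Tm C' l
  | _, .cst c => ρ.val c
  | _, .var k => .var (k * (n + 1))
  | _, .app t N => .app (apps (rel μ ρ t) (copies μ N)) (rel μ ρ N)
  | _, .lam A t =>
      lams 0 (copies μ A) (.lam (apps ((rel μ ρ A).shift n) (vars n)) (rel μ ρ t))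
  | _, .pi A B =>
      lams 0 (copies μ (.pi A B))
        (pis 0 ((copies μ A).map (Tm.shift n))
          (.pi (apps ((rel μ ρ A).shift (n + n)) (vars n))
            (apps ((rel μ ρ B).rename fun k => if k < n + 1 then k else k + n)
              (List.ofFn fun i : Fin n => .app (.var (n + n - i)) (.var (n - i))))))

/-- The mapping `λ*` on kinds: `relK μ ρ K R` is `λ*^R(K)`, for a source type `R`. -/
def relK (μ : Fin n → Params C C') (ρ : Params C C') : Kd C → Tm C .ty → Kd C'
  | .type, R => pisK 0 (copies μ R) .type
  | .pi A K, R =>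
      pisK 0 (copies μ A)
        (.pi (apps ((rel μ ρ A).shift n) (vars n)) (relK μ ρ K (.app (R.shift 1) (.var 0))))

/-- The mapping `λ*` on contexts. -/
def relCtx (μ : Fin n → Params C C') (ρ : Params C C') : Ctx C → Ctx C'
  | [] => []
  | A :: Γ => apps ((rel μ ρ A).shift n) (vars n) :: extend 0 (copies μ A) (relCtx μ ρ Γ)

/-- The parameters `ρ` form a logical relation on `μ₁, …, μₙ`, from `S` to `T`. -/
structure IsLogicalRelation (η : Bool) (S : Theory C) (T : Theory C')
    (μ : Fin n → Params C C') (ρ : Params C C') : Prop where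
  morphism : ∀ i, IsMorphism η S T (μ i)
  obj : ∀ (c : C .obj) (A : Tm C .ty), Decl.obj c A ∈ S →
    HasType η T [] (ρ.val c) (apps (rel μ ρ A) (copies μ (.cst c)))
  ty : ∀ (a : C .ty) (K : Kd C), Decl.ty a K ∈ S →
    HasKind η T [] (ρ.val a) (relK μ ρ K (.cst a))
  rule : ∀ {l : Lvl} (lhs rhs : Tm C l), Decl.rule lhs rhs ∈ S →
    Conv η T (rel μ ρ lhs) (rel μ ρ rhs)

end LogicalRelations

end LPR

/-!
# Abstraction theorem for the lambda-Pi-calculus modulo rewriting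

The theorem is proved by induction on derivations in the source theory `S`, for the four forms of
judgments at once (`Judg.Abstraction`, `IsLogicalRelation.abstraction`). The invariant for
`Γ ⊢ K : Kind` speaks of all source types of kind `K`, since `λ*` interprets a kind relative to a
type; well-formedness of translated types is recovered in the target.

Two facts about `λ*` carry the argument. It commutes with substitution (`rel_subst`): a source
substitution `σ` acts on target terms by sending `xᵢ` to `μᵢ(σ x)` and `x*` to `λ*(σ x)`
(`relSub`). Hence it maps beta- and eta-steps and instances of rewrite rules to conversions
(`IsLogicalRelation.rel_conv`), by beta and eta for whole blocks `x₁, …, xₙ, x*`. Moreover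
`λ*(Π x : A. B) F₁ … Fₙ` is convertible to the product
`Π x₁ … xₙ. Π x*. λ*(B) (F₁ x₁) … (Fₙ xₙ)` (`conv_rel_pi`).

Conversion is untyped and the rewrite rules are arbitrary, so neither confluence nor injectivity of
products nor subject reduction is available. They are avoided as follows. When an application
`M N` is translated, the type `λ*(Π x : A. B) μ⃗(M)` of `λ*(M)` must be replaced by the above
product, whose well-formedness has to be shown. The type of a typable object is well formed
(`HasType.hasKind`, which uses that the target theory is well formed). Inverting the derivation of
that fact down through the applications and the abstractions `λ f₁ … fₙ` shows that the body of
`λ*(Π x : A. B)` is a well-formed type, and the substitution lemma instantiates it at `μ⃗(M)`.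
The typing of `μᵢ(M)` is the preservation of judgments by morphisms (`IsMorphism.derives`), followed
by the renaming of `x` to `xᵢ` (`wfRen_copy`).
-/

namespace LPR

/-! ### Substitution calculus -/

section SubstitutionCalculus

variable {C : Lvl → Type*} {l : Lvl}

theorem up_var_comp (f : ℕ → ℕ) :
    up (fun i => (.var (f i) : Tm C .obj)) = fun i => .var (liftRen f i) := by
  funext i; cases i <;> rfl

theorem up_var : up (.var : ℕ → Tm C .obj) = .var := by
  funext i; cases i <;> rfl

theorem Tm.rename_eq_subst (t : Tm C l) (f : ℕ → ℕ) :
    t.rename f = t.subst (fun i => .var (f i)) := by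
  induction t generalizing f <;> simp_all [Tm.rename, Tm.subst, up_var_comp]

theorem Tm.subst_var (t : Tm C l) : t.subst .var = t := by
  induction t <;> simp_all [Tm.subst, up_var]

theorem Kd.subst_var (K : Kd C) : K.subst .var = K := by
  induction K <;> simp_all [Kd.subst, up_var, Tm.subst_var]

theorem up_comp_liftRen (σ : ℕ → Tm C .obj) (f : ℕ → ℕ) :
    (fun i => up σ (liftRen f i)) = up (fun i => σ (f i)) := by
  funext i; cases i <;> rfl

theorem Tm.subst_rename (t : Tm C l) (f : ℕ → ℕ) (σ : ℕ → Tm C .obj) :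
    (t.rename f).subst σ = t.subst (fun i => σ (f i)) := by
  induction t generalizing f σ <;> simp_all [Tm.rename, Tm.subst, up_comp_liftRen]

theorem Tm.rename_rename (t : Tm C l) (f g : ℕ → ℕ) :
    (t.rename f).rename g = t.rename (fun i => g (f i)) := by
  rw [rename_eq_subst, subst_rename, rename_eq_subst]

theorem rename_up (σ : ℕ → Tm C .obj) (f : ℕ → ℕ) :
    (fun i => (up σ i).rename (liftRen f)) = up (fun i => (σ i).rename f) := by
  funext i; cases i <;> simp [up, Tm.rename, liftRen, Tm.shift, Tm.rename_rename]

theorem Tm.rename_subst (t : Tm C l) (σ : ℕ → Tm C .obj) (f : ℕ → ℕ) :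
    (t.subst σ).rename f = t.subst (fun i => (σ i).rename f) := by
  induction t generalizing f σ <;> simp_all [Tm.rename, Tm.subst, rename_up]

theorem subst_up (σ τ : ℕ → Tm C .obj) :
    (fun i => (up σ i).subst (up τ)) = up (fun i => (σ i).subst τ) := by
  funext i
  cases i <;> simp [up, Tm.subst, Tm.shift, Tm.rename_subst, Tm.subst_rename]

theorem Tm.subst_subst (t : Tm C l) (σ τ : ℕ → Tm C .obj) :
    (t.subst σ).subst τ = t.subst (fun i => (σ i).subst τ) := by
  induction t generalizing σ τ <;> simp_all [Tm.subst, subst_up]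

theorem Kd.subst_subst (K : Kd C) (σ τ : ℕ → Tm C .obj) :
    (K.subst σ).subst τ = K.subst (fun i => (σ i).subst τ) := by
  induction K generalizing σ τ <;> simp_all [Kd.subst, subst_up, Tm.subst_subst]

theorem Tm.shift_eq_subst (t : Tm C l) (k : ℕ) :
    t.shift k = t.subst (fun i => .var (i + k)) := rename_eq_subst _ _

theorem Tm.shift_zero (t : Tm C l) : t.shift 0 = t := by
  rw [shift_eq_subst]; exact subst_var t

theorem Tm.subst_shift (t : Tm C l) (k : ℕ) (σ : ℕ → Tm C .obj) :
    (t.shift k).subst σ = t.subst (fun i => σ (i + k)) := subst_rename _ _ _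

theorem Tm.shift_shift (t : Tm C l) (j k : ℕ) : (t.shift j).shift k = t.shift (j + k) := by
  simp only [shift, rename_rename, Nat.add_assoc]

theorem Tm.shift_subst (t : Tm C l) (k : ℕ) (σ : ℕ → Tm C .obj) :
    (t.subst σ).shift k = t.subst (fun i => (σ i).shift k) := rename_subst _ _ _

theorem Tm.subst_congr (t : Tm C l) {σ τ : ℕ → Tm C .obj} (h : ∀ i, σ i = τ i) :
    t.subst σ = t.subst τ := by rw [funext h]

/-- A substitution pushed under `k` binders. -/
def upN : ℕ → (ℕ → Tm C .obj) → ℕ → Tm C .obj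
  | 0, σ => σ
  | k + 1, σ => up (upN k σ)

theorem upN_of_lt (σ : ℕ → Tm C .obj) : ∀ {k j : ℕ}, j < k → upN k σ j = .var j
  | k + 1, 0, _ => rfl
  | k + 1, j + 1, h => by
    simp [upN, up, upN_of_lt σ (Nat.lt_of_succ_lt_succ h), Tm.shift, Tm.rename]

theorem upN_add (σ : ℕ → Tm C .obj) (k j : ℕ) : upN k σ (j + k) = (σ j).shift k := by
  induction k with
  | zero => exact (Tm.shift_zero _).symm
  | succ k ih =>
    have : upN (k + 1) σ (j + (k + 1)) = (upN k σ (j + k)).shift 1 := rfl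
    rw [this, ih, Tm.shift_shift]

theorem upN_of_le (σ : ℕ → Tm C .obj) {k j : ℕ} (h : k ≤ j) :
    upN k σ j = (σ (j - k)).shift k := by
  rw [← upN_add, Nat.sub_add_cancel h]

theorem Tm.shift_subst_upN (t : Tm C l) (k : ℕ) (σ : ℕ → Tm C .obj) :
    (t.shift k).subst (upN k σ) = (t.subst σ).shift k := by
  rw [subst_shift, shift_subst]; exact subst_congr _ fun i => upN_add σ k i

theorem Tm.shift_subst_up (t : Tm C l) (σ : ℕ → Tm C .obj) :
    (t.shift 1).subst (up σ) = (t.subst σ).shift 1 := shift_subst_upN t 1 σ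

/-- The substitution that maps the innermost variable to `N` and the others like `σ`. -/
def scons (N : Tm C .obj) (σ : ℕ → Tm C .obj) : ℕ → Tm C .obj
  | 0 => N
  | k + 1 => σ k

theorem single_eq_scons (N : Tm C .obj) : single N = scons N .var := by
  funext i; cases i <;> rfl

theorem up_subst_single (τ : ℕ → Tm C .obj) (N : Tm C .obj) :
    (fun i => (up τ i).subst (single N)) = scons N τ := by
  funext i
  cases i with
  | zero => rfl
  | succ i => exact (Tm.subst_shift _ _ _).trans (Tm.subst_var _)

theorem Tm.inst_subst_up (t : Tm C l) (τ : ℕ → Tm C .obj) (N : Tm C .obj) :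
    (t.subst (up τ)).inst N = t.subst (scons N τ) := by
  rw [inst, subst_subst, up_subst_single]

theorem Kd.inst_subst_up (K : Kd C) (τ : ℕ → Tm C .obj) (N : Tm C .obj) :
    (K.subst (up τ)).inst N = K.subst (scons N τ) := by
  rw [inst, subst_subst, up_subst_single]

theorem single_subst (N : Tm C .obj) (σ : ℕ → Tm C .obj) :
    (fun i => (single N i).subst σ) = scons (N.subst σ) σ := by
  funext i; cases i <;> rfl

theorem Tm.subst_inst (t : Tm C l) (N : Tm C .obj) (σ : ℕ → Tm C .obj) :
    (t.inst N).subst σ = (t.subst (up σ)).inst (N.subst σ) := by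
  rw [inst_subst_up, inst, subst_subst, single_subst]

theorem Kd.subst_inst (K : Kd C) (N : Tm C .obj) (σ : ℕ → Tm C .obj) :
    (K.inst N).subst σ = (K.subst (up σ)).inst (N.subst σ) := by
  rw [inst_subst_up, inst, subst_subst, single_subst]

theorem Tm.inst_shift (t : Tm C l) (N : Tm C .obj) : (t.shift 1).inst N = t := by
  rw [inst, subst_shift]; exact subst_var t

/-- The substitution that maps the innermost variables to the members of a list, the last member
replacing the innermost variable, and the others like `τ`. -/
def instL : (ℕ → Tm C .obj) → List (Tm C .obj) → ℕ → Tm C .obj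
  | τ, [] => τ
  | τ, N :: Ns => instL (scons N τ) Ns

theorem instL_add (τ : ℕ → Tm C .obj) (Ns : List (Tm C .obj)) (j : ℕ) :
    instL τ Ns (j + Ns.length) = τ j := by
  induction Ns generalizing τ j with
  | nil => rfl
  | cons N Ns ih =>
    rw [List.length_cons, instL, show j + (Ns.length + 1) = (j + 1) + Ns.length by omega, ih]
    rfl

theorem instL_getElem (τ : ℕ → Tm C .obj) (Ns : List (Tm C .obj)) (i : ℕ) (h : i < Ns.length) :
    instL τ Ns (Ns.length - 1 - i) = Ns[i] := by
  induction Ns generalizing τ i with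
  | nil => simp at h
  | cons N Ns ih =>
    cases i with
    | zero =>
      have := instL_add (scons N τ) Ns 0
      simpa [instL, scons] using this
    | succ i =>
      have h' : i < Ns.length := by simpa using h
      have := ih (scons N τ) i h'
      rw [List.getElem_cons_succ, ← this, instL, List.length_cons]
      congr 1; omega

theorem instL_ofFn (τ : ℕ → Tm C .obj) {n : ℕ} (F : Fin n → Tm C .obj) (i : Fin n) :
    instL τ (List.ofFn F) (n - 1 - i) = F i := by
  have := instL_getElem τ (List.ofFn F) i (by simp)
  simpa using this

theorem instL_ofFn_add (τ : ℕ → Tm C .obj) {n : ℕ} (F : Fin n → Tm C .obj) (j : ℕ) :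
    instL τ (List.ofFn F) (j + n) = τ j := by
  have := instL_add τ (List.ofFn F) j
  simpa using this

end SubstitutionCalculus

section TelescopeSubstitution

variable {C : Lvl → Type*} {l : Lvl}

theorem apps_cons (t : Tm C l) (N : Tm C .obj) (Ns : List (Tm C .obj)) :
    apps t (N :: Ns) = apps (.app t N) Ns := rfl

theorem apps_subst (t : Tm C l) (Ns : List (Tm C .obj)) (σ : ℕ → Tm C .obj) :
    (apps t Ns).subst σ = apps (t.subst σ) (Ns.map (Tm.subst σ)) := by
  induction Ns generalizing t with
  | nil => rfl
  | cons N Ns ih => simp [apps_cons, ih, Tm.subst]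

theorem apps_shift (t : Tm C l) (Ns : List (Tm C .obj)) (k : ℕ) :
    (apps t Ns).shift k = apps (t.shift k) (Ns.map (Tm.shift k)) := by
  simp [Tm.shift_eq_subst, apps_subst, funext fun t : Tm C .obj => t.shift_eq_subst k]

/-- The members of a telescope live outside of its binders, so a substitution reaches them without
being pushed under those. -/
theorem lams_subst (k : ℕ) (As : List (Tm C .ty)) (t : Tm C l) (σ : ℕ → Tm C .obj) :
    (lams k As t).subst (upN k σ) =
      lams k (As.map (Tm.subst σ)) (t.subst (upN (k + As.length) σ)) := by
  induction As generalizing k with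
  | nil => rfl
  | cons A As ih =>
    have := ih (k + 1)
    simp only [lams, Tm.subst, Tm.shift_subst_upN, List.map_cons, List.length_cons]
    rw [show up (upN k σ) = upN (k + 1) σ from rfl, this,
      show k + (As.length + 1) = k + 1 + As.length by omega]

theorem pis_subst (k : ℕ) (As : List (Tm C .ty)) (B : Tm C .ty) (σ : ℕ → Tm C .obj) :
    (pis k As B).subst (upN k σ) =
      pis k (As.map (Tm.subst σ)) (B.subst (upN (k + As.length) σ)) := by
  induction As generalizing k with
  | nil => rfl
  | cons A As ih =>
    have := ih (k + 1)
    simp only [pis, Tm.subst, Tm.shift_subst_upN, List.map_cons, List.length_cons]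
    rw [show up (upN k σ) = upN (k + 1) σ from rfl, this,
      show k + (As.length + 1) = k + 1 + As.length by omega]

theorem pisK_subst (k : ℕ) (As : List (Tm C .ty)) (K : Kd C) (σ : ℕ → Tm C .obj) :
    (pisK k As K).subst (upN k σ) =
      pisK k (As.map (Tm.subst σ)) (K.subst (upN (k + As.length) σ)) := by
  induction As generalizing k with
  | nil => rfl
  | cons A As ih =>
    have := ih (k + 1)
    simp only [pisK, Kd.subst, Tm.shift_subst_upN, List.map_cons, List.length_cons]
    rw [show up (upN k σ) = upN (k + 1) σ from rfl, this,
      show k + (As.length + 1) = k + 1 + As.length by omega]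

theorem vars_succ (n : ℕ) : (vars (n + 1) : List (Tm C .obj)) = .var n :: vars n := by
  simp only [vars, List.ofFn_succ]
  congr 2
  funext i
  simp only [Fin.val_succ]
  congr 1; omega

theorem vars_subst_upN {n k : ℕ} (h : n ≤ k) (σ : ℕ → Tm C .obj) :
    (vars n).map (Tm.subst (upN k σ)) = vars n := by
  simp only [vars, List.map_ofFn]
  congr 1; funext i
  exact upN_of_lt σ (by omega)

theorem vars_subst_instL {n : ℕ} (τ : ℕ → Tm C .obj) (F : Fin n → Tm C .obj) :
    (vars n).map (Tm.subst (instL τ (List.ofFn F))) = List.ofFn F := by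
  simp only [vars, List.map_ofFn]
  congr 1; funext i
  exact instL_ofFn τ F i

theorem extend_getElem_add (k : ℕ) (As : List (Tm C .ty)) (Γ : Ctx C) (j : ℕ) :
    (extend k As Γ)[j + As.length]? = Γ[j]? := by
  induction As generalizing k Γ j with
  | nil => rfl
  | cons A As ih =>
    rw [extend, List.length_cons, show j + (As.length + 1) = (j + 1) + As.length by omega, ih,
      List.getElem?_cons_succ]

theorem extend_getElem (k : ℕ) (As : List (Tm C .ty)) (Γ : Ctx C) (i : ℕ) (h : i < As.length) :
    (extend k As Γ)[As.length - 1 - i]? = some (As[i].shift (k + i)) := by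
  induction As generalizing k Γ i with
  | nil => simp at h
  | cons A As ih =>
    cases i with
    | zero =>
      have := extend_getElem_add (k + 1) As (A.shift k :: Γ) 0
      simpa [extend] using this
    | succ i =>
      have h' : i < As.length := by simpa using h
      rw [List.getElem_cons_succ, extend, List.length_cons,
        show As.length + 1 - 1 - (i + 1) = As.length - 1 - i by omega, ih _ _ i h',
        show k + 1 + i = k + (i + 1) by omega]

end TelescopeSubstitution

/-! ### Conversion -/

section Conversion

variable {C : Lvl → Type*} {l : Lvl} {η : Bool} {T : Theory C}

theorem Step.subst {t t' : Tm C l} (h : Step η T t t') (σ : ℕ → Tm C .obj) :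
    Step η T (t.subst σ) (t'.subst σ) := by
  induction h generalizing σ with
  | beta A t N => rw [Tm.subst_inst]; exact .beta _ _ _
  | eta hη A t =>
    simp only [Tm.subst, Tm.shift_subst_up]
    exact .eta hη _ _
  | rule h τ => rw [Tm.subst_subst, Tm.subst_subst]; exact .rule h _
  | lam_left _ ih => exact .lam_left (ih _)
  | lam_right _ ih => exact .lam_right (ih _)
  | app_left _ ih => exact .app_left (ih _)
  | app_right _ ih => exact .app_right (ih _)
  | pi_left _ ih => exact .pi_left (ih _)
  | pi_right _ ih => exact .pi_right (ih _)

theorem StepK.subst {K K' : Kd C} (h : StepK η T K K') (σ : ℕ → Tm C .obj) :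
    StepK η T (K.subst σ) (K'.subst σ) := by
  induction h generalizing σ with
  | pi_left h => exact .pi_left (h.subst _)
  | pi_right _ ih => exact .pi_right (ih _)

theorem Step.mono {T' : Theory C} (hT : ∀ d ∈ T, d ∈ T') {t t' : Tm C l}
    (h : Step η T t t') : Step η T' t t' := by
  induction h with
  | beta A t N => exact .beta _ _ _
  | eta hη A t => exact .eta hη _ _
  | rule h τ => exact .rule (hT _ h) _
  | lam_left _ ih => exact .lam_left ih
  | lam_right _ ih => exact .lam_right ih
  | app_left _ ih => exact .app_left ih
  | app_right _ ih => exact .app_right ih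
  | pi_left _ ih => exact .pi_left ih
  | pi_right _ ih => exact .pi_right ih

theorem StepK.mono {T' : Theory C} (hT : ∀ d ∈ T, d ∈ T') {K K' : Kd C}
    (h : StepK η T K K') : StepK η T' K K' := by
  induction h with
  | pi_left h => exact .pi_left (h.mono hT)
  | pi_right _ ih => exact .pi_right ih

/-- A map that sends the generators of an equivalence relation into an equivalence relation
sends the whole of it there. -/
theorem eqvGen_map {α β : Type*} {r : α → α → Prop} {s : β → β → Prop} (f : α → β)
    (hf : ∀ a b, r a b → Relation.EqvGen s (f a) (f b)) {a b : α} (h : Relation.EqvGen r a b) :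
    Relation.EqvGen s (f a) (f b) := by
  induction h with
  | rel a b h => exact hf a b h
  | refl a => exact .refl _
  | symm a b _ ih => exact .symm _ _ ih
  | trans a b c _ _ ih₁ ih₂ => exact .trans _ _ _ ih₁ ih₂

namespace Conv

theorem refl (t : Tm C l) : Conv η T t t := Relation.EqvGen.refl t

theorem symm {t t' : Tm C l} (h : Conv η T t t') : Conv η T t' t := Relation.EqvGen.symm _ _ h

theorem trans {t t' t'' : Tm C l} (h : Conv η T t t') (h' : Conv η T t' t'') :
    Conv η T t t'' := Relation.EqvGen.trans _ _ _ h h'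

theorem of_step {t t' : Tm C l} (h : Step η T t t') : Conv η T t t' := .rel _ _ h

theorem of_eq {t t' : Tm C l} (h : t = t') : Conv η T t t' := h ▸ refl t

theorem subst {t t' : Tm C l} (h : Conv η T t t') (σ : ℕ → Tm C .obj) :
    Conv η T (t.subst σ) (t'.subst σ) :=
  eqvGen_map _ (fun _ _ h => of_step (h.subst σ)) h

theorem rename {t t' : Tm C l} (h : Conv η T t t') (f : ℕ → ℕ) :
    Conv η T (t.rename f) (t'.rename f) := by
  rw [Tm.rename_eq_subst, Tm.rename_eq_subst]; exact h.subst _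

theorem shift {t t' : Tm C l} (h : Conv η T t t') (k : ℕ) :
    Conv η T (t.shift k) (t'.shift k) := h.rename _

theorem mono {T' : Theory C} (hT : ∀ d ∈ T, d ∈ T') {t t' : Tm C l}
    (h : Conv η T t t') : Conv η T' t t' :=
  eqvGen_map id (fun _ _ h => of_step (h.mono hT)) h

theorem lam {A A' : Tm C .ty} {t t' : Tm C l} (hA : Conv η T A A') (ht : Conv η T t t') :
    Conv η T (.lam A t) (.lam A' t') :=
  trans (eqvGen_map (fun A => Tm.lam A t) (fun _ _ h => of_step (.lam_left h)) hA)
    (eqvGen_map (fun t => Tm.lam A' t) (fun _ _ h => of_step (.lam_right h)) ht)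

theorem app {t t' : Tm C l} {N N' : Tm C .obj} (ht : Conv η T t t') (hN : Conv η T N N') :
    Conv η T (.app t N) (.app t' N') :=
  trans (eqvGen_map (fun t => Tm.app t N) (fun _ _ h => of_step (.app_left h)) ht)
    (eqvGen_map (fun N => Tm.app t' N) (fun _ _ h => of_step (.app_right h)) hN)

theorem pi {A A' B B' : Tm C .ty} (hA : Conv η T A A') (hB : Conv η T B B') :
    Conv η T (.pi A B) (.pi A' B') :=
  trans (eqvGen_map (fun A => Tm.pi A B) (fun _ _ h => of_step (.pi_left h)) hA)
    (eqvGen_map (fun B => Tm.pi A' B) (fun _ _ h => of_step (.pi_right h)) hB)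

theorem beta (A : Tm C .ty) (t : Tm C l) (N : Tm C .obj) :
    Conv η T (.app (.lam A t) N) (t.inst N) := of_step (.beta A t N)

theorem apps {t t' : Tm C l} {Ns Ns' : List (Tm C .obj)} (ht : Conv η T t t')
    (hN : List.Forall₂ (Conv η T) Ns Ns') : Conv η T (apps t Ns) (LPR.apps t' Ns') := by
  induction hN generalizing t t' with
  | nil => exact ht
  | cons h _ ih => exact ih (ht.app h)

theorem lams {As As' : List (Tm C .ty)} (hA : List.Forall₂ (Conv η T) As As')
    (k : ℕ) {t t' : Tm C l} (ht : Conv η T t t') :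
    Conv η T (lams k As t) (LPR.lams k As' t') := by
  induction hA generalizing k with
  | nil => exact ht
  | cons h _ ih => exact (h.shift k).lam (ih _)

theorem pis {As As' : List (Tm C .ty)} (hA : List.Forall₂ (Conv η T) As As')
    (k : ℕ) {B B' : Tm C .ty} (hB : Conv η T B B') :
    Conv η T (pis k As B) (LPR.pis k As' B') := by
  induction hA generalizing k with
  | nil => exact hB
  | cons h _ ih => exact (h.shift k).pi (ih _)

/-- Beta-reduction of a whole block of abstractions. -/
theorem beta_apps (k : ℕ) (As : List (Tm C .ty)) (t : Tm C l) (τ : ℕ → Tm C .obj)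
    (Ns : List (Tm C .obj)) (h : As.length = Ns.length) :
    Conv η T (LPR.apps ((LPR.lams k As t).subst τ) Ns) (t.subst (instL τ Ns)) := by
  induction As generalizing k τ Ns with
  | nil =>
    obtain rfl : Ns = [] := by simpa using h.symm
    exact refl _
  | cons A As ih =>
    obtain _ | ⟨N, Ns⟩ := Ns
    · simp at h
    change Conv η T (LPR.apps (.app (.lam ((A.shift k).subst τ)
      ((LPR.lams (k + 1) As t).subst (up τ))) N) Ns) _
    refine trans (apps (beta (Tm.subst τ (A.shift k)) _ N)
      (List.forall₂_same.2 fun _ _ => refl _)) ?_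
    rw [Tm.inst_subst_up]
    exact ih _ _ _ (by simpa using h)

/-- Eta-expansion by a whole block of abstractions. -/
theorem eta_lams (hη : η = true) (k : ℕ) (As : List (Tm C .ty)) (t : Tm C l) :
    Conv η T t (LPR.lams k As (LPR.apps (t.shift As.length) (vars As.length))) := by
  induction As generalizing k t with
  | nil => exact of_eq (Tm.shift_zero t).symm
  | cons A As ih =>
    refine trans (of_step (.eta hη (A.shift k) t)) (lam (refl _) (trans (ih (k + 1) _) ?_))
    apply of_eq
    simp only [List.length_cons, vars_succ, apps_cons]
    rw [show (Tm.app (t.shift 1) (.var 0)).shift As.length =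
      .app ((t.shift 1).shift As.length) (.var (0 + As.length)) from rfl, Tm.shift_shift,
      Nat.zero_add, Nat.add_comm 1]

end Conv

namespace ConvK

theorem refl (K : Kd C) : ConvK η T K K := Relation.EqvGen.refl K

theorem trans {K K' K'' : Kd C} (h : ConvK η T K K') (h' : ConvK η T K' K'') :
    ConvK η T K K'' := Relation.EqvGen.trans _ _ _ h h'

theorem subst {K K' : Kd C} (h : ConvK η T K K') (σ : ℕ → Tm C .obj) :
    ConvK η T (K.subst σ) (K'.subst σ) :=
  eqvGen_map _ (fun _ _ h => .rel _ _ (h.subst σ)) h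

theorem mono {T' : Theory C} (hT : ∀ d ∈ T, d ∈ T') {K K' : Kd C}
    (h : ConvK η T K K') : ConvK η T' K K' :=
  eqvGen_map id (fun _ _ h => .rel _ _ (h.mono hT)) h

theorem pi {A A' : Tm C .ty} {K K' : Kd C} (hA : Conv η T A A') (hK : ConvK η T K K') :
    ConvK η T (.pi A K) (.pi A' K') :=
  trans (eqvGen_map (fun A => Kd.pi A K) (fun _ _ h => .rel _ _ (.pi_left h)) hA)
    (eqvGen_map (fun K => Kd.pi A' K) (fun _ _ h => .rel _ _ (.pi_right h)) hK)

theorem pisK {As As' : List (Tm C .ty)} (hA : List.Forall₂ (Conv η T) As As')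
    (k : ℕ) {K K' : Kd C} (hK : ConvK η T K K') :
    ConvK η T (pisK k As K) (LPR.pisK k As' K') := by
  induction hA generalizing k with
  | nil => exact hK
  | cons h _ ih => exact pi (h.shift k) (ih _)

end ConvK

end Conversion

/-! ### Metatheory of typing -/

section Metatheory

variable {C : Lvl → Type*} {η : Bool} {T : Theory C}

/-- The context of a judgment. -/
def Judg.context : Judg C → Ctx C
  | .ctx Γ => Γ
  | .obj Γ _ _ => Γ
  | .ty Γ _ _ => Γ
  | .kind Γ _ => Γ

theorem Derives.wfCtx_context {J : Judg C} (h : Derives η T J) : WfCtx η T J.context := by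
  induction h with
  | empty => exact .empty
  | decl h h' _ _ => exact .decl h h'
  | _ => assumption

theorem HasType.wfCtx {Γ : Ctx C} {M : Tm C .obj} {A : Tm C .ty} (h : HasType η T Γ M A) :
    WfCtx η T Γ := h.wfCtx_context

theorem HasKind.wfCtx {Γ : Ctx C} {A : Tm C .ty} {K : Kd C} (h : HasKind η T Γ A K) :
    WfCtx η T Γ := h.wfCtx_context

theorem HasKind.wfCtx_cons {Γ : Ctx C} {A : Tm C .ty} (h : HasKind η T Γ A .type) :
    WfCtx η T (A :: Γ) := .decl h.wfCtx h

/-- The statement that a judgment over `Γ` stays derivable under all substitutions from `Γ` to a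
well-formed context that belong to the class `W`. -/
def Judg.Stable (η : Bool) (T : Theory C) (W : (ℕ → Tm C .obj) → Ctx C → Ctx C → Prop) :
    Judg C → Prop
  | .ctx _ => True
  | .obj Γ M A => ∀ σ Δ, W σ Γ Δ → WfCtx η T Δ → HasType η T Δ (M.subst σ) (A.subst σ)
  | .ty Γ A K => ∀ σ Δ, W σ Γ Δ → WfCtx η T Δ → HasKind η T Δ (A.subst σ) (K.subst σ)
  | .kind Γ K => ∀ σ Δ, W σ Γ Δ → WfCtx η T Δ → WfKind η T Δ (K.subst σ)

/-- Every class of substitutions that are well typed on variables, leave the types of the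
constants alone and can be pushed under binders preserves derivability. It is used for
renamings, and then for substitutions. -/
theorem Derives.stable {W : (ℕ → Tm C .obj) → Ctx C → Ctx C → Prop}
    (hvar : ∀ σ Γ Δ, W σ Γ Δ → WfCtx η T Δ → ∀ i A, Γ[i]? = some A →
      HasType η T Δ (σ i) ((A.shift (i + 1)).subst σ))
    (hup : ∀ σ Γ Δ A, W σ Γ Δ → WfCtx η T (A.subst σ :: Δ) → W (up σ) (A :: Γ) (A.subst σ :: Δ))
    (hobj : ∀ c A σ, Decl.obj c A ∈ T → A.subst σ = A)
    (hty : ∀ a K σ, Decl.ty a K ∈ T → K.subst σ = K)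
    {J : Judg C} (h : Derives η T J) : J.Stable η T W := by
  induction h with
  | empty => trivial
  | decl => trivial
  | const_obj h _ _ =>
    intro σ Δ _ hΔ
    rw [hobj _ _ σ h]; exact .const_obj h hΔ
  | var h _ _ => intro σ Δ hσ hΔ; exact hvar σ _ _ hσ hΔ _ _ h
  | abs_obj _ _ _ ihA ihB ihM =>
    intro σ Δ hσ hΔ
    have hA := ihA σ Δ hσ hΔ
    have hW := hup _ _ _ _ hσ hA.wfCtx_cons
    exact .abs_obj hA (ihB _ _ hW hA.wfCtx_cons) (ihM _ _ hW hA.wfCtx_cons)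
  | app_obj _ _ ihM ihN =>
    intro σ Δ hσ hΔ
    rw [Tm.subst_inst]
    exact .app_obj (ihM σ Δ hσ hΔ) (ihN σ Δ hσ hΔ)
  | conv_type hc _ _ ihM ihB =>
    intro σ Δ hσ hΔ
    exact .conv_type (hc.subst σ) (ihM σ Δ hσ hΔ) (ihB σ Δ hσ hΔ)
  | const_type h _ _ =>
    intro σ Δ _ hΔ
    rw [hty _ _ σ h]; exact .const_type h hΔ
  | prod_type _ _ ihA ihB =>
    intro σ Δ hσ hΔ
    have hA := ihA σ Δ hσ hΔ
    exact .prod_type hA (ihB _ _ (hup _ _ _ _ hσ hA.wfCtx_cons) hA.wfCtx_cons)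
  | abs_type _ _ _ ihA ihK ihB =>
    intro σ Δ hσ hΔ
    have hA := ihA σ Δ hσ hΔ
    have hW := hup _ _ _ _ hσ hA.wfCtx_cons
    exact .abs_type hA (ihK _ _ hW hA.wfCtx_cons) (ihB _ _ hW hA.wfCtx_cons)
  | app_type _ _ ihA ihM =>
    intro σ Δ hσ hΔ
    rw [Kd.subst_inst]
    exact .app_type (ihA σ Δ hσ hΔ) (ihM σ Δ hσ hΔ)
  | conv_kind hc _ _ ihA ihK =>
    intro σ Δ hσ hΔ
    exact .conv_kind (hc.subst σ) (ihA σ Δ hσ hΔ) (ihK σ Δ hσ hΔ)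
  | sort => intro σ Δ _ hΔ; exact .sort hΔ
  | prod_kind _ _ ihA ihK =>
    intro σ Δ hσ hΔ
    have hA := ihA σ Δ hσ hΔ
    exact .prod_kind hA (ihK _ _ (hup _ _ _ _ hσ hA.wfCtx_cons) hA.wfCtx_cons)

/-- All free variables of the term or kind that a judgment is about are declared in its context:
it is fixed by every substitution that fixes the declared variables. -/
def Judg.Scoped : Judg C → Prop
  | .ctx _ => True
  | .obj Γ M _ => ∀ σ, (∀ i < Γ.length, σ i = .var i) → M.subst σ = M
  | .ty Γ A _ => ∀ σ, (∀ i < Γ.length, σ i = .var i) → A.subst σ = A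
  | .kind Γ K => ∀ σ, (∀ i < Γ.length, σ i = .var i) → K.subst σ = K

theorem up_eq_var {σ : ℕ → Tm C .obj} {k : ℕ} (h : ∀ i < k, σ i = .var i) :
    ∀ i < k + 1, up σ i = .var i
  | 0, _ => rfl
  | i + 1, hi => by simp [up, h i (by omega), Tm.shift, Tm.rename]

theorem Derives.scoped {J : Judg C} (h : Derives η T J) : J.Scoped := by
  induction h with
  | empty => trivial
  | decl => trivial
  | const_obj => intro σ _; rfl
  | var h => intro σ hσ; exact hσ _ (List.getElem?_eq_some_iff.1 h).1
  | abs_obj _ _ _ ihA _ ihM =>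
    intro σ hσ; rw [Tm.subst, ihA σ hσ, ihM _ (up_eq_var hσ)]
  | app_obj _ _ ihM ihN => intro σ hσ; rw [Tm.subst, ihM σ hσ, ihN σ hσ]
  | conv_type _ _ _ ihM _ => exact ihM
  | const_type => intro σ _; rfl
  | prod_type _ _ ihA ihB => intro σ hσ; rw [Tm.subst, ihA σ hσ, ihB _ (up_eq_var hσ)]
  | abs_type _ _ _ ihA _ ihB => intro σ hσ; rw [Tm.subst, ihA σ hσ, ihB _ (up_eq_var hσ)]
  | app_type _ _ ihA ihM => intro σ hσ; rw [Tm.subst, ihA σ hσ, ihM σ hσ]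
  | conv_kind _ _ _ ihA _ => exact ihA
  | sort => intro σ _; rfl
  | prod_kind _ _ ihA ihK => intro σ hσ; rw [Kd.subst, ihA σ hσ, ihK _ (up_eq_var hσ)]

/-- Enlarging a theory preserves derivability. -/
theorem Derives.mono {T' : Theory C} (hT : ∀ d ∈ T, d ∈ T') {J : Judg C} (h : Derives η T J) :
    Derives η T' J := by
  induction h with
  | empty => exact .empty
  | decl _ _ ih₁ ih₂ => exact .decl ih₁ ih₂
  | const_obj h _ ih => exact .const_obj (hT _ h) ih
  | var h _ ih => exact .var h ih
  | abs_obj _ _ _ ih₁ ih₂ ih₃ => exact .abs_obj ih₁ ih₂ ih₃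
  | app_obj _ _ ih₁ ih₂ => exact .app_obj ih₁ ih₂
  | conv_type h _ _ ih₁ ih₂ => exact .conv_type (h.mono hT) ih₁ ih₂
  | const_type h _ ih => exact .const_type (hT _ h) ih
  | prod_type _ _ ih₁ ih₂ => exact .prod_type ih₁ ih₂
  | abs_type _ _ _ ih₁ ih₂ ih₃ => exact .abs_type ih₁ ih₂ ih₃
  | app_type _ _ ih₁ ih₂ => exact .app_type ih₁ ih₂
  | conv_kind h _ _ ih₁ ih₂ => exact .conv_kind (h.mono hT) ih₁ ih₂
  | sort _ ih => exact .sort ih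
  | prod_kind _ _ ih₁ ih₂ => exact .prod_kind ih₁ ih₂

theorem Theory.Wf.hasKind_decl (hT : T.Wf η) {c : C .obj} {A : Tm C .ty}
    (h : Decl.obj c A ∈ T) : HasKind η T [] A .type := by
  induction hT with
  | empty => simp at h
  | decl_obj _ _ hA ih =>
    refine Derives.mono (fun d hd => List.mem_cons_of_mem _ hd) ?_
    rcases List.mem_cons.1 h with h | h
    · cases h; exact hA
    · exact ih h
  | decl_type _ _ _ ih =>
    refine Derives.mono (fun d hd => List.mem_cons_of_mem _ hd) (ih ?_)
    simpa using h
  | rewr _ _ ih =>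
    refine Derives.mono (fun d hd => List.mem_cons_of_mem _ hd) (ih ?_)
    simpa using h

theorem Theory.Wf.wfKind_decl (hT : T.Wf η) {a : C .ty} {K : Kd C}
    (h : Decl.ty a K ∈ T) : WfKind η T [] K := by
  induction hT with
  | empty => simp at h
  | decl_type _ _ hA ih =>
    refine Derives.mono (fun d hd => List.mem_cons_of_mem _ hd) ?_
    rcases List.mem_cons.1 h with h | h
    · cases h; exact hA
    · exact ih h
  | decl_obj _ _ _ ih =>
    refine Derives.mono (fun d hd => List.mem_cons_of_mem _ hd) (ih ?_)
    simpa using h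
  | rewr _ _ ih =>
    refine Derives.mono (fun d hd => List.mem_cons_of_mem _ hd) (ih ?_)
    simpa using h

theorem Theory.Wf.subst_decl (hT : T.Wf η) (c : C .obj) (A : Tm C .ty) (σ : ℕ → Tm C .obj)
    (h : Decl.obj c A ∈ T) : A.subst σ = A :=
  (hT.hasKind_decl h).scoped σ (by simp)

theorem Theory.Wf.substKd_decl (hT : T.Wf η) (a : C .ty) (K : Kd C) (σ : ℕ → Tm C .obj)
    (h : Decl.ty a K ∈ T) : K.subst σ = K :=
  (hT.wfKind_decl h).scoped σ (by simp)

/-- The renaming `f` sends the variables of `Γ` to variables of `Δ` with the renamed types. -/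
def WfRen (f : ℕ → ℕ) (Γ Δ : Ctx C) : Prop :=
  ∀ i A, Γ[i]? = some A →
    ∃ B, Δ[f i]? = some B ∧ B.shift (f i + 1) = (A.shift (i + 1)).rename f

theorem WfRen.lift {f : ℕ → ℕ} {Γ Δ : Ctx C} (h : WfRen f Γ Δ) (A : Tm C .ty) :
    WfRen (liftRen f) (A :: Γ) (A.rename f :: Δ) := by
  rintro (_ | i) A' hA
  · obtain rfl : A = A' := by simpa using hA
    exact ⟨_, rfl, by simp [Tm.shift, Tm.rename_rename, liftRen]⟩
  · obtain ⟨B, hB, hBA⟩ := h i A' (by simpa using hA)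
    refine ⟨B, by simpa [liftRen] using hB, ?_⟩
    have := congrArg (Tm.shift 1) hBA
    simp only [Tm.shift, Tm.rename_rename, liftRen] at this ⊢
    exact this

theorem Derives.stable_rename (hT : T.Wf η) {J : Judg C} (h : Derives η T J) :
    J.Stable η T (fun σ Γ Δ => ∃ f, σ = (fun i => .var (f i)) ∧ WfRen f Γ Δ) := by
  refine h.stable ?_ ?_ hT.subst_decl hT.substKd_decl
  · rintro _ Γ Δ ⟨f, rfl, hf⟩ hΔ i A hA
    obtain ⟨B, hB, hBA⟩ := hf i A hA
    rw [← Tm.rename_eq_subst, ← hBA]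
    exact .var hB hΔ
  · rintro _ Γ Δ A ⟨f, rfl, hf⟩ _
    refine ⟨liftRen f, up_var_comp f, ?_⟩
    rw [← Tm.rename_eq_subst]; exact hf.lift A

theorem HasType.rename (hT : T.Wf η) {Γ Δ : Ctx C} {M : Tm C .obj} {A : Tm C .ty} {f : ℕ → ℕ}
    (h : HasType η T Γ M A) (hf : WfRen f Γ Δ) (hΔ : WfCtx η T Δ) :
    HasType η T Δ (M.rename f) (A.rename f) := by
  rw [Tm.rename_eq_subst, Tm.rename_eq_subst]
  exact h.stable_rename hT _ Δ ⟨f, rfl, hf⟩ hΔ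

theorem HasKind.rename (hT : T.Wf η) {Γ Δ : Ctx C} {A : Tm C .ty} {K : Kd C} {f : ℕ → ℕ}
    (h : HasKind η T Γ A K) (hf : WfRen f Γ Δ) (hΔ : WfCtx η T Δ) :
    HasKind η T Δ (A.rename f) (K.subst fun i => .var (f i)) := by
  rw [Tm.rename_eq_subst]
  exact h.stable_rename hT _ Δ ⟨f, rfl, hf⟩ hΔ

theorem wfRen_shift_one (Γ : Ctx C) (A : Tm C .ty) : WfRen (· + 1) Γ (A :: Γ) := fun i B hB =>
  ⟨B, by simpa using hB, (Tm.shift_shift B (i + 1) 1).symm⟩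

theorem wfRen_nil (f : ℕ → ℕ) (Γ : Ctx C) : WfRen f [] Γ := fun i A h => by simp at h

theorem WfRen.comp {f g : ℕ → ℕ} {Γ Δ Θ : Ctx C} (hg : WfRen g Δ Θ) (hf : WfRen f Γ Δ) :
    WfRen (fun i => g (f i)) Γ Θ := fun i A hA => by
  obtain ⟨B, hB, hBA⟩ := hf i A hA
  obtain ⟨D, hD, hDB⟩ := hg _ B hB
  exact ⟨D, hD, by rw [hDB, hBA, Tm.rename_rename]⟩

/-- The substitution `σ` sends the variables of `Γ` to terms over `Δ` of the substituted types. -/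
def WfSub (η : Bool) (T : Theory C) (σ : ℕ → Tm C .obj) (Γ Δ : Ctx C) : Prop :=
  ∀ i A, Γ[i]? = some A → HasType η T Δ (σ i) ((A.shift (i + 1)).subst σ)

theorem WfSub.up (hT : T.Wf η) {σ : ℕ → Tm C .obj} {Γ Δ : Ctx C} (h : WfSub η T σ Γ Δ)
    {A : Tm C .ty} (hA : WfCtx η T (A.subst σ :: Δ)) :
    WfSub η T (up σ) (A :: Γ) (A.subst σ :: Δ) := by
  rintro (_ | i) A' hA'
  · obtain rfl : A = A' := by simpa using hA'
    rw [Tm.shift_subst_up]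
    exact .var rfl hA
  · have := HasType.rename hT (h i A' (by simpa using hA')) (wfRen_shift_one Δ (A.subst σ)) hA
    rw [← Tm.shift_shift A' (i + 1) 1, Tm.shift_subst_up]
    exact this

theorem WfSub.scons {σ : ℕ → Tm C .obj} {Γ Δ : Ctx C} (h : WfSub η T σ Γ Δ)
    {A : Tm C .ty} {N : Tm C .obj} (hN : HasType η T Δ N (A.subst σ)) :
    WfSub η T (scons N σ) (A :: Γ) Δ := by
  rintro (_ | i) A' hA'
  · obtain rfl : A = A' := by simpa using hA'
    rw [Tm.subst_shift]
    exact hN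
  · have := h i A' (by simpa using hA')
    rw [Tm.subst_shift] at this ⊢
    exact this

theorem wfSub_var {Γ : Ctx C} (h : WfCtx η T Γ) : WfSub η T .var Γ Γ := fun i A hA => by
  rw [Tm.subst_var]; exact .var hA h

theorem Derives.stable_subst (hT : T.Wf η) {J : Judg C} (h : Derives η T J) :
    J.Stable η T (WfSub η T) :=
  h.stable (fun _ _ _ hσ _ => hσ) (fun _ _ _ _ hσ hA => WfSub.up hT hσ hA) hT.subst_decl
    hT.substKd_decl

theorem HasType.subst (hT : T.Wf η) {Γ Δ : Ctx C} {M : Tm C .obj} {A : Tm C .ty}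
    {σ : ℕ → Tm C .obj} (h : HasType η T Γ M A) (hσ : WfSub η T σ Γ Δ) (hΔ : WfCtx η T Δ) :
    HasType η T Δ (M.subst σ) (A.subst σ) := h.stable_subst hT σ Δ hσ hΔ

theorem HasKind.subst (hT : T.Wf η) {Γ Δ : Ctx C} {A : Tm C .ty} {K : Kd C}
    {σ : ℕ → Tm C .obj} (h : HasKind η T Γ A K) (hσ : WfSub η T σ Γ Δ) (hΔ : WfCtx η T Δ) :
    HasKind η T Δ (A.subst σ) (K.subst σ) := h.stable_subst hT σ Δ hσ hΔ

/-- Closed judgments hold in every well-formed context, without renaming. -/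
theorem HasType.of_nil (hT : T.Wf η) {Γ : Ctx C} {M : Tm C .obj} {A : Tm C .ty}
    (h : HasType η T [] M A) (hΓ : WfCtx η T Γ) : HasType η T Γ M A := by
  have := h.subst hT (σ := .var) (fun i A h => by simp at h) hΓ
  rwa [Tm.subst_var, Tm.subst_var] at this

theorem HasKind.of_nil (hT : T.Wf η) {Γ : Ctx C} {A : Tm C .ty} {K : Kd C}
    (h : HasKind η T [] A K) (hΓ : WfCtx η T Γ) : HasKind η T Γ A K := by
  have := h.subst hT (σ := .var) (fun i A h => by simp at h) hΓ
  rwa [Tm.subst_var, Kd.subst_var] at this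

/-- Inversion of the typing of products. -/
theorem HasKind.pi_inv {Γ : Ctx C} {A B : Tm C .ty} {K : Kd C}
    (h : HasKind η T Γ (.pi A B) K) :
    HasKind η T Γ A .type ∧ HasKind η T (A :: Γ) B .type := by
  unfold HasKind at h
  generalize hJ : Judg.ty Γ (.pi A B) K = J at h
  induction h generalizing K with
  | prod_type h₁ h₂ _ _ =>
    cases hJ
    exact ⟨h₁, h₂⟩
  | conv_kind _ _ _ ih _ =>
    cases hJ
    exact ih rfl
  | _ => cases hJ

/-- Inversion of the typing of abstractions on types. Without confluence, nothing is said on how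
the kind of the body relates to that of the abstraction. -/
theorem HasKind.lam_inv {Γ : Ctx C} {A B : Tm C .ty} {K : Kd C}
    (h : HasKind η T Γ (.lam A B) K) :
    HasKind η T Γ A .type ∧ ∃ K', HasKind η T (A :: Γ) B K' := by
  unfold HasKind at h
  generalize hJ : Judg.ty Γ (.lam A B) K = J at h
  induction h generalizing K with
  | abs_type h₁ _ h₂ _ _ _ =>
    cases hJ
    exact ⟨h₁, _, h₂⟩
  | conv_kind _ _ _ ih _ =>
    cases hJ
    exact ih rfl
  | _ => cases hJ

theorem HasKind.app_inv {Γ : Ctx C} {A : Tm C .ty} {N : Tm C .obj} {K : Kd C}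
    (h : HasKind η T Γ (.app A N) K) : ∃ K', HasKind η T Γ A K' := by
  unfold HasKind at h
  generalize hJ : Judg.ty Γ (.app A N) K = J at h
  induction h generalizing K with
  | app_type h _ _ _ =>
    cases hJ
    exact ⟨_, h⟩
  | conv_kind _ _ _ ih _ =>
    cases hJ
    exact ih rfl
  | _ => cases hJ

/-- Every type in a well-formed context is well formed over the preceding entries. -/
theorem WfCtx.getElem (hT : T.Wf η) {Γ : Ctx C} (h : WfCtx η T Γ) {i : ℕ} {A : Tm C .ty}
    (hA : Γ[i]? = some A) : HasKind η T Γ (A.shift (i + 1)) .type := by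
  induction Γ generalizing i with
  | nil => simp at hA
  | cons B Γ ih =>
    have hB := h
    rcases h with _ | ⟨hΓ, hBk⟩
    have key : ∀ {D : Tm C .ty}, HasKind η T Γ D .type →
        HasKind η T (B :: Γ) (D.shift 1) .type := fun hD =>
      HasKind.rename hT hD (wfRen_shift_one Γ B) hB
    rcases i with _ | i
    · obtain rfl : B = A := by simpa using hA
      exact key hBk
    · rw [← Tm.shift_shift]
      exact key (ih hΓ (by simpa using hA))

/-- The type of a well-typed object is well formed. -/
theorem HasType.hasKind (hT : T.Wf η) {Γ : Ctx C} {M : Tm C .obj} {A : Tm C .ty}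
    (h : HasType η T Γ M A) : HasKind η T Γ A .type := by
  unfold HasType at h
  generalize hJ : Judg.obj Γ M A = J at h
  induction h generalizing Γ M A with
  | const_obj h hΓ _ =>
    cases hJ
    exact (hT.hasKind_decl h).of_nil hT hΓ
  | var h hΓ _ =>
    cases hJ
    exact WfCtx.getElem hT hΓ h
  | abs_obj h₁ h₂ _ _ _ _ =>
    cases hJ
    exact .prod_type h₁ h₂
  | app_obj _ hN ihM _ =>
    cases hJ
    have hΓ := HasType.wfCtx hN
    refine HasKind.subst hT (ihM rfl).pi_inv.2 ?_ hΓ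
    rw [single_eq_scons]
    exact (wfSub_var hΓ).scons (by rwa [Tm.subst_var])
  | conv_type _ _ h _ _ =>
    cases hJ
    exact h
  | _ => cases hJ

end Metatheory

/-! ### Typing of telescopes -/

section TelescopeTyping

variable {C : Lvl → Type*} {η : Bool} {T : Theory C}

theorem wfRen_extend (k : ℕ) (As : List (Tm C .ty)) (Γ : Ctx C) :
    WfRen (· + As.length) Γ (extend k As Γ) := fun i A hA =>
  ⟨A, by rw [extend_getElem_add]; exact hA, by
    change _ = (A.shift (i + 1)).shift As.length
    rw [Tm.shift_shift, Nat.add_right_comm]⟩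

theorem HasKind.shift_one (hT : T.Wf η) {Γ : Ctx C} {A B : Tm C .ty}
    (hA : HasKind η T Γ A .type) (hB : WfCtx η T (B :: Γ)) :
    HasKind η T (B :: Γ) (A.shift 1) .type :=
  HasKind.rename hT hA (wfRen_shift_one Γ B) hB

theorem hasKind_shift_cons (hT : T.Wf η) {k : ℕ} {A : Tm C .ty} {As : List (Tm C .ty)}
    {Γ : Ctx C} (h : ∀ B ∈ A :: As, HasKind η T Γ (B.shift k) .type) :
    HasKind η T Γ (A.shift k) .type ∧
      ∀ B ∈ As, HasKind η T (A.shift k :: Γ) (B.shift (k + 1)) .type := by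
  have hA := h A List.mem_cons_self
  refine ⟨hA, fun B hB => ?_⟩
  rw [← Tm.shift_shift]
  exact (h B (List.mem_cons_of_mem _ hB)).shift_one hT hA.wfCtx_cons

theorem WfCtx.extend (hT : T.Wf η) {k : ℕ} {As : List (Tm C .ty)} {Γ : Ctx C}
    (hΓ : WfCtx η T Γ) (h : ∀ A ∈ As, HasKind η T Γ (A.shift k) .type) :
    WfCtx η T (extend k As Γ) := by
  induction As generalizing k Γ with
  | nil => exact hΓ
  | cons A As ih =>
    obtain ⟨hA, hAs⟩ := hasKind_shift_cons hT h
    exact ih hA.wfCtx_cons hAs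

theorem HasKind.pis (hT : T.Wf η) {k : ℕ} {As : List (Tm C .ty)} {Γ : Ctx C} {B : Tm C .ty}
    (h : ∀ A ∈ As, HasKind η T Γ (A.shift k) .type)
    (hB : HasKind η T (LPR.extend k As Γ) B .type) :
    HasKind η T Γ (LPR.pis k As B) .type := by
  induction As generalizing k Γ with
  | nil => exact hB
  | cons A As ih =>
    obtain ⟨hA, hAs⟩ := hasKind_shift_cons hT h
    exact .prod_type hA (ih hAs hB)

theorem WfKind.pisK (hT : T.Wf η) {k : ℕ} {As : List (Tm C .ty)} {Γ : Ctx C} {K : Kd C}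
    (h : ∀ A ∈ As, HasKind η T Γ (A.shift k) .type)
    (hK : WfKind η T (LPR.extend k As Γ) K) :
    WfKind η T Γ (LPR.pisK k As K) := by
  induction As generalizing k Γ with
  | nil => exact hK
  | cons A As ih =>
    obtain ⟨hA, hAs⟩ := hasKind_shift_cons hT h
    exact .prod_kind hA (ih hAs hK)

theorem HasType.lams (hT : T.Wf η) {k : ℕ} {As : List (Tm C .ty)} {Γ : Ctx C} {B : Tm C .ty}
    {M : Tm C .obj} (h : ∀ A ∈ As, HasKind η T Γ (A.shift k) .type)
    (hM : HasType η T (LPR.extend k As Γ) M B) :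
    HasType η T Γ (LPR.lams k As M) (LPR.pis k As B) := by
  induction As generalizing k Γ with
  | nil => exact hM
  | cons A As ih =>
    obtain ⟨hA, hAs⟩ := hasKind_shift_cons hT h
    exact .abs_obj hA (HasKind.pis hT hAs (HasType.hasKind hT hM)) (ih hAs hM)

theorem HasKind.lams (hT : T.Wf η) {k : ℕ} {As : List (Tm C .ty)} {Γ : Ctx C} {B : Tm C .ty}
    {K : Kd C} (h : ∀ A ∈ As, HasKind η T Γ (A.shift k) .type)
    (hK : WfKind η T (LPR.extend k As Γ) K) (hB : HasKind η T (LPR.extend k As Γ) B K) :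
    HasKind η T Γ (LPR.lams k As B) (LPR.pisK k As K) := by
  induction As generalizing k Γ with
  | nil => exact hB
  | cons A As ih =>
    obtain ⟨hA, hAs⟩ := hasKind_shift_cons hT h
    exact .abs_type hA (WfKind.pisK hT hAs hK) (ih hAs hK hB)

theorem shift_subst_eq {l : Lvl} {k : ℕ} {τ : ℕ → Tm C .obj} (hτ : ∀ j, τ (j + k) = .var j)
    (t : Tm C l) : (t.shift k).subst τ = t := by
  rw [Tm.subst_shift]
  exact (Tm.subst_congr _ hτ).trans t.subst_var

/-- Application to a block of arguments. The substitution `τ` collects the arguments that have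
been passed before. -/
theorem HasType.apps {Γ : Ctx C} {M : Tm C .obj} {B : Tm C .ty} {k : ℕ}
    {As : List (Tm C .ty)} {Ns : List (Tm C .obj)} {τ : ℕ → Tm C .obj}
    (hτ : ∀ j, τ (j + k) = .var j) (hM : HasType η T Γ M ((LPR.pis k As B).subst τ))
    (hN : List.Forall₂ (HasType η T Γ) Ns As) :
    HasType η T Γ (LPR.apps M Ns) (B.subst (instL τ Ns)) := by
  induction hN generalizing M k τ with
  | nil => exact hM
  | @cons N A Ns As hN _ ih =>
    have hM' : HasType η T Γ M (.pi A ((LPR.pis (k + 1) As B).subst (up τ))) := by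
      have : (LPR.pis k (A :: As) B).subst τ = .pi A ((LPR.pis (k + 1) As B).subst (up τ)) :=
        congrArg (Tm.pi · _) (shift_subst_eq hτ A)
      rwa [this] at hM
    refine ih (τ := scons N τ) (k := k + 1) hτ ?_
    rw [← Tm.inst_subst_up]
    exact .app_obj hM' hN

theorem HasKind.apps {Γ : Ctx C} {A : Tm C .ty} {K : Kd C} {k : ℕ}
    {As : List (Tm C .ty)} {Ns : List (Tm C .obj)} {τ : ℕ → Tm C .obj}
    (hτ : ∀ j, τ (j + k) = .var j) (hA : HasKind η T Γ A ((LPR.pisK k As K).subst τ))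
    (hN : List.Forall₂ (HasType η T Γ) Ns As) :
    HasKind η T Γ (LPR.apps A Ns) (K.subst (instL τ Ns)) := by
  induction hN generalizing A k τ with
  | nil => exact hA
  | @cons N B Ns As hN _ ih =>
    have hA' : HasKind η T Γ A (.pi B ((LPR.pisK (k + 1) As K).subst (up τ))) := by
      have : (LPR.pisK k (B :: As) K).subst τ =
          .pi B ((LPR.pisK (k + 1) As K).subst (up τ)) :=
        congrArg (Kd.pi · _) (shift_subst_eq hτ B)
      rwa [this] at hA
    refine ih (τ := scons N τ) (k := k + 1) hτ ?_
    rw [← Kd.inst_subst_up]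
    exact .app_type hA' hN

theorem WfSub.instL {Γ Δ : Ctx C} {k : ℕ} {As : List (Tm C .ty)} {Ns : List (Tm C .obj)}
    {τ : ℕ → Tm C .obj} (hτ : ∀ j, τ (j + k) = .var j) (h : WfSub η T τ Δ Γ)
    (hN : List.Forall₂ (HasType η T Γ) Ns As) :
    WfSub η T (instL τ Ns) (extend k As Δ) Γ := by
  induction hN generalizing Δ k τ with
  | nil => exact h
  | @cons N A Ns As hN _ ih =>
    exact ih (τ := LPR.scons N τ) (k := k + 1) hτ (h.scons (by rwa [shift_subst_eq hτ]))

theorem WfSub.upN (hT : T.Wf η) {σ : ℕ → Tm C .obj} {Γ Δ : Ctx C} {k : ℕ}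
    {As : List (Tm C .ty)} (hσ : WfSub η T (upN k σ) Γ Δ)
    (h : ∀ A ∈ As.map (Tm.subst σ), HasKind η T Δ (A.shift k) .type) :
    WfSub η T (LPR.upN (k + As.length) σ) (extend k As Γ)
      (extend k (As.map (Tm.subst σ)) Δ) := by
  induction As generalizing k Γ Δ with
  | nil => exact hσ
  | cons A As ih =>
    obtain ⟨hA, hAs⟩ := hasKind_shift_cons hT h
    rw [List.length_cons, show k + (As.length + 1) = k + 1 + As.length by omega]
    refine ih (k := k + 1) ?_ hAs
    have := hσ.up hT (A := A.shift k) (by rw [Tm.shift_subst_upN]; exact hA.wfCtx_cons)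
    rwa [Tm.shift_subst_upN] at this

theorem HasType.extend_var {Γ : Ctx C} {As : List (Tm C .ty)}
    (h : WfCtx η T (LPR.extend 0 As Γ)) (i : ℕ) (hi : i < As.length) :
    HasType η T (LPR.extend 0 As Γ) (.var (As.length - 1 - i)) (As[i].shift As.length) := by
  have := Derives.var (extend_getElem 0 As Γ i hi) h
  rw [Tm.shift_shift] at this
  rwa [show 0 + i + (As.length - 1 - i + 1) = As.length by omega] at this

theorem HasKind.pi_type {Γ : Ctx C} {A B : Tm C .ty} {K : Kd C}
    (h : HasKind η T Γ (.pi A B) K) : HasKind η T Γ (.pi A B) .type :=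
  .prod_type h.pi_inv.1 h.pi_inv.2

/-- A telescope of products can only have been formed as a type, whatever kind `K` conversion
has given it; the final product covers the empty telescope. -/
theorem HasKind.pis_pi_type {Γ : Ctx C} {k : ℕ} {As : List (Tm C .ty)} {A B : Tm C .ty} {K : Kd C}
    (h : HasKind η T Γ (LPR.pis k As (.pi A B)) K) :
    HasKind η T Γ (LPR.pis k As (.pi A B)) .type := by
  cases As with
  | nil => exact h.pi_type
  | cons => exact HasKind.pi_type h

theorem HasKind.lams_inv {Γ : Ctx C} {k : ℕ} {As : List (Tm C .ty)} {B : Tm C .ty} {K : Kd C}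
    (h : HasKind η T Γ (LPR.lams k As B) K) :
    ∃ K', HasKind η T (LPR.extend k As Γ) B K' := by
  induction As generalizing k Γ K with
  | nil => exact ⟨K, h⟩
  | cons A As ih =>
    obtain ⟨-, K', h'⟩ := HasKind.lam_inv h
    exact ih h'

theorem HasKind.apps_inv {Γ : Ctx C} {A : Tm C .ty} {Ns : List (Tm C .obj)} {K : Kd C}
    (h : HasKind η T Γ (LPR.apps A Ns) K) : ∃ K', HasKind η T Γ A K' := by
  induction Ns generalizing A with
  | nil => exact ⟨K, h⟩
  | cons N Ns ih =>
    obtain ⟨K', h'⟩ := ih h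
    exact HasKind.app_inv h'

end TelescopeTyping

/-! ### Theory morphisms -/

section MorphismTyping

variable {C : Lvl → Type*} {C' : Lvl → Type*} {l : Lvl} {η : Bool} {S : Theory C}
  {T : Theory C'}

theorem Params.tm_rename (m : Params C C') (t : Tm C l) (f : ℕ → ℕ) :
    m.tm (t.rename f) = (m.tm t).rename f := by
  induction t generalizing f with
  | cst c => rw [Tm.rename, Params.tm, Tm.rename_eq_subst, m.closed]
  | _ => simp_all [Tm.rename, Params.tm]

theorem Params.tm_up (m : Params C C') (σ : ℕ → Tm C .obj) :
    (fun i => m.tm (up σ i)) = up fun i => m.tm (σ i) := by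
  funext i
  cases i with
  | zero => rfl
  | succ i => exact m.tm_rename _ _

theorem Params.tm_subst (m : Params C C') (t : Tm C l) (σ : ℕ → Tm C .obj) :
    m.tm (t.subst σ) = (m.tm t).subst fun i => m.tm (σ i) := by
  induction t generalizing σ with
  | cst c => rw [Tm.subst, Params.tm, m.closed]
  | _ => simp_all [Tm.subst, Params.tm, Params.tm_up]

theorem Params.kd_subst (m : Params C C') (K : Kd C) (σ : ℕ → Tm C .obj) :
    m.kd (K.subst σ) = (m.kd K).subst fun i => m.tm (σ i) := by
  induction K generalizing σ with
  | type => rfl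
  | pi A K ih => simp [Kd.subst, Params.kd, m.tm_subst, ih, Params.tm_up]

theorem Params.tm_single (m : Params C C') (N : Tm C .obj) :
    (fun i => m.tm (single N i)) = single (m.tm N) := by
  funext i; cases i <;> rfl

theorem Params.tm_inst (m : Params C C') (t : Tm C l) (N : Tm C .obj) :
    m.tm (t.inst N) = (m.tm t).inst (m.tm N) := by
  rw [Tm.inst, m.tm_subst, m.tm_single]; rfl

theorem Params.kd_inst (m : Params C C') (K : Kd C) (N : Tm C .obj) :
    m.kd (K.inst N) = (m.kd K).inst (m.tm N) := by
  rw [Kd.inst, m.kd_subst, m.tm_single]; rfl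

theorem IsMorphism.conv_step {m : Params C C'} (hm : IsMorphism η S T m) {t t' : Tm C l}
    (h : Step η S t t') : Conv η T (m.tm t) (m.tm t') := by
  induction h with
  | beta A t N => rw [m.tm_inst]; exact .beta _ _ _
  | eta hη A t =>
    refine .of_step ?_
    have := Step.eta (T := T) hη (m.tm A) (m.tm t)
    rwa [Tm.shift, ← m.tm_rename] at this
  | rule h σ => rw [m.tm_subst, m.tm_subst]; exact (hm.rule _ _ h).subst _
  | lam_left _ ih => exact ih.lam (.refl _)
  | lam_right _ ih => exact .lam (.refl _) ih
  | app_left _ ih => exact ih.app (.refl _)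
  | app_right _ ih => exact .app (.refl _) ih
  | pi_left _ ih => exact ih.pi (.refl _)
  | pi_right _ ih => exact .pi (.refl _) ih

theorem IsMorphism.conv {m : Params C C'} (hm : IsMorphism η S T m) {t t' : Tm C l}
    (h : Conv η S t t') : Conv η T (m.tm t) (m.tm t') :=
  eqvGen_map _ (fun _ _ => hm.conv_step) h

theorem IsMorphism.convK_step {m : Params C C'} (hm : IsMorphism η S T m) {K K' : Kd C}
    (h : StepK η S K K') : ConvK η T (m.kd K) (m.kd K') := by
  induction h with
  | pi_left h => exact .pi (hm.conv_step h) (.refl _)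
  | pi_right _ ih => exact .pi (.refl _) ih

theorem IsMorphism.convK {m : Params C C'} (hm : IsMorphism η S T m) {K K' : Kd C}
    (h : ConvK η S K K') : ConvK η T (m.kd K) (m.kd K') :=
  eqvGen_map m.kd (fun _ _ => hm.convK_step) h

/-- The homomorphic extension of parameters to judgments. -/
def Params.judg (m : Params C C') : Judg C → Judg C'
  | .ctx Γ => .ctx (Γ.map m.tm)
  | .obj Γ M A => .obj (Γ.map m.tm) (m.tm M) (m.tm A)
  | .ty Γ A K => .ty (Γ.map m.tm) (m.tm A) (m.kd K)
  | .kind Γ K => .kind (Γ.map m.tm) (m.kd K)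

/-- Theory morphisms preserve all judgments. -/
theorem IsMorphism.derives (hT : T.Wf η) {m : Params C C'} (hm : IsMorphism η S T m)
    {J : Judg C} (h : Derives η S J) : Derives η T (m.judg J) := by
  induction h with
  | empty => exact .empty
  | decl _ _ ih₁ ih₂ => exact .decl ih₁ ih₂
  | const_obj h _ ih => exact HasType.of_nil hT (hm.obj _ _ h) ih
  | @var Γ i A h _ ih =>
    have := Derives.var (i := i) (A := m.tm A) (by simp [h]) ih
    rwa [Tm.shift, ← m.tm_rename] at this
  | abs_obj _ _ _ ih₁ ih₂ ih₃ => exact .abs_obj ih₁ ih₂ ih₃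
  | app_obj _ _ ih₁ ih₂ =>
    rw [Params.judg, m.tm_inst]
    exact .app_obj ih₁ ih₂
  | conv_type h _ _ ih₁ ih₂ => exact .conv_type (hm.conv h) ih₁ ih₂
  | const_type h _ ih => exact HasKind.of_nil hT (hm.ty _ _ h) ih
  | prod_type _ _ ih₁ ih₂ => exact .prod_type ih₁ ih₂
  | abs_type _ _ _ ih₁ ih₂ ih₃ => exact .abs_type ih₁ ih₂ ih₃
  | app_type _ _ ih₁ ih₂ =>
    rw [Params.judg, m.kd_inst]
    exact .app_type ih₁ ih₂
  | conv_kind h _ _ ih₁ ih₂ => exact .conv_kind (hm.convK h) ih₁ ih₂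
  | sort _ ih => exact .sort ih
  | prod_kind _ _ ih₁ ih₂ => exact .prod_kind ih₁ ih₂

end MorphismTyping

/-! ### Logical relations, substitution and conversion -/

section RelationSubstitution

variable {C : Lvl → Type*} {C' : Lvl → Type*} {l : Lvl} {n : ℕ}
  (μ : Fin n → Params C C') (ρ : Params C C')

theorem copies_length (t : Tm C l) : (copies μ t).length = n := by simp [copies]

theorem copy_var (i : Fin n) (k : ℕ) : copy μ i (.var k) = .var (k * (n + 1) + (n - i)) := rfl

/-- Two functions agree if they agree on all members of the blocks `x₁, …, xₙ, x*`. -/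
theorem block_ext {α : Type*} (n : ℕ) {f g : ℕ → α} (h₀ : ∀ k, f (k * (n + 1)) = g (k * (n + 1)))
    (h₁ : ∀ k (i : Fin n), f (k * (n + 1) + (n - i)) = g (k * (n + 1) + (n - i))) : f = g := by
  funext j
  have hj := Nat.div_add_mod' j (n + 1)
  have hlt : j % (n + 1) < n + 1 := Nat.mod_lt j n.succ_pos
  by_cases h : j % (n + 1) = 0
  · rw [← hj, h]; exact h₀ _
  · have := h₁ (j / (n + 1)) ⟨n - j % (n + 1), by omega⟩
    have e : n - (n - j % (n + 1)) = j % (n + 1) := by omega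
    simp only [e, hj] at this
    exact this

/-- The substitution on target terms that is induced by a substitution `σ` on source terms: it
sends `xᵢ` to `μᵢ(σ x)` and `x*` to `λ*(σ x)`. -/
def relSub (σ : ℕ → Tm C .obj) (j : ℕ) : Tm C' .obj :=
  if h : j % (n + 1) = 0 then rel μ ρ (σ (j / (n + 1)))
  else copy μ ⟨n - j % (n + 1), by
    have : j % (n + 1) < n + 1 := Nat.mod_lt j n.succ_pos
    omega⟩ (σ (j / (n + 1)))

theorem relSub_star (σ : ℕ → Tm C .obj) (k : ℕ) :
    relSub μ ρ σ (k * (n + 1)) = rel μ ρ (σ k) := by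
  simp [relSub]

theorem relSub_copy (σ : ℕ → Tm C .obj) (k : ℕ) (i : Fin n) :
    relSub μ ρ σ (k * (n + 1) + (n - i)) = copy μ i (σ k) := by
  have h₁ : (k * (n + 1) + (n - i)) % (n + 1) = n - i := by
    rw [Nat.mul_add_mod_self_right, Nat.mod_eq_of_lt]; omega
  have h₂ : (k * (n + 1) + (n - i)) / (n + 1) = k := by
    rw [Nat.add_comm, Nat.add_mul_div_right _ _ n.succ_pos, Nat.div_eq_of_lt] <;> omega
  have h₃ : ¬ n - (i : ℕ) = 0 := by omega
  simp only [relSub, h₁, h₂, h₃, dite_false]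
  congr 1
  apply Fin.ext
  simp only
  omega

theorem copy_subst (i : Fin n) (t : Tm C l) (σ : ℕ → Tm C .obj) :
    copy μ i (t.subst σ) = (copy μ i t).subst (relSub μ ρ σ) := by
  simp only [copy, Params.tm_subst, Tm.rename_subst, Tm.subst_rename, relSub_copy]

theorem copies_subst (t : Tm C l) (σ : ℕ → Tm C .obj) :
    copies μ (t.subst σ) = (copies μ t).map (Tm.subst (relSub μ ρ σ)) := by
  simp only [copies, List.map_ofFn]
  congr 1; funext i; exact copy_subst μ ρ i t σ

theorem copy_shift (i : Fin n) (t : Tm C l) (k : ℕ) :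
    copy μ i (t.shift k) = (copy μ i t).shift (k * (n + 1)) := by
  simp only [copy, Tm.shift, Params.tm_rename, Tm.rename_rename]
  congr 1; funext j; ring

/-- The telescope `Π x₁ : A₁. … Π xₙ : Aₙ. Π x* : D x₁ … xₙ. E (F₁ x₁) … (Fₙ xₙ)`, which occurs
in the interpretation of products. Only `E` lives under the binders. -/
def relProd (n : ℕ) (As : List (Tm C' .ty)) (D E : Tm C' .ty) (F : Fin n → Tm C' .obj) :
    Tm C' .ty :=
  pis 0 As (.pi (apps (D.shift n) (vars n))
    (apps E (List.ofFn fun i : Fin n => .app ((F i).shift (n + 1)) (.var (n - i)))))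

theorem relProd_subst {As : List (Tm C' .ty)} (hAs : As.length = n) (D E : Tm C' .ty)
    (F : Fin n → Tm C' .obj) (σ : ℕ → Tm C' .obj) :
    (relProd n As D E F).subst σ = relProd n (As.map (Tm.subst σ)) (D.subst σ)
      (E.subst (upN (n + 1) σ)) (fun i => (F i).subst σ) := by
  have h := pis_subst 0 As (.pi (apps (D.shift n) (vars n))
    (apps E (List.ofFn fun i : Fin n => .app ((F i).shift (n + 1)) (.var (n - i))))) σ
  rw [Nat.zero_add, hAs] at h
  refine h.trans (congrArg (pis 0 _) ?_)
  rw [Tm.subst, apps_subst, apps_subst, Tm.shift_subst_upN, vars_subst_upN le_rfl,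
    List.map_ofFn, show up (upN n σ) = upN (n + 1) σ from rfl]
  congr 3; funext i
  simp only [Function.comp, Tm.subst, Tm.shift_subst_upN]
  rw [upN_of_lt _ (by omega)]

/-- The clause for products in terms of `relProd`. -/
theorem rel_pi (A B : Tm C .ty) :
    rel μ ρ (.pi A B) = lams 0 (copies μ (.pi A B))
      (relProd n ((copies μ A).map (Tm.shift n)) ((rel μ ρ A).shift n)
        ((rel μ ρ B).subst (upN (n + 1) fun j => .var (j + n))) fun i => .var (n - 1 - i)) := by
  rw [rel, relProd, Tm.shift_shift, Tm.rename_eq_subst]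
  congr 5
  · funext j
    split_ifs with h
    · rw [upN_of_lt _ h]
    · rw [upN_of_le _ (by omega)]
      simp only [Tm.shift, Tm.rename]
      congr 1; omega
  · funext i
    simp only [Tm.shift, Tm.rename]
    congr 2; omega

theorem subst_upN (k : ℕ) (σ τ : ℕ → Tm C .obj) :
    (fun i => (upN k σ i).subst (upN k τ)) = upN k fun i => (σ i).subst τ := by
  induction k with
  | zero => rfl
  | succ k ih => rw [upN, upN, upN, subst_up, ih]

theorem upN_var (k : ℕ) : upN k (.var : ℕ → Tm C .obj) = .var := by
  induction k with
  | zero => rfl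
  | succ k ih => rw [upN, ih, up_var]

/-- Pushing `σ` under a source binder pushes the induced substitution under the `n + 1` target
binders of the block. -/
theorem relSub_up {σ : ℕ → Tm C .obj}
    (h : ∀ k, rel μ ρ ((σ k).shift 1) = (rel μ ρ (σ k)).shift (n + 1)) :
    relSub μ ρ (up σ) = upN (n + 1) (relSub μ ρ σ) := by
  refine block_ext n ?_ ?_
  · rintro (_ | k)
    · rw [relSub_star, Nat.zero_mul, upN_of_lt _ n.succ_pos]
      simp [up, rel]
    · rw [relSub_star, Nat.succ_mul, upN_add, relSub_star]
      exact h k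
  · rintro (_ | k) i
    · rw [relSub_copy, Nat.zero_mul, Nat.zero_add, upN_of_lt _ (by omega)]
      simp [up, copy_var]
    · rw [relSub_copy, Nat.succ_mul, Nat.add_right_comm, upN_add, relSub_copy]
      exact (copy_shift μ i (σ k) 1).trans (by rw [Nat.one_mul])

theorem map_shift_subst_upN (As : List (Tm C l)) (k : ℕ) (σ : ℕ → Tm C .obj) :
    (As.map (Tm.shift k)).map (Tm.subst (upN k σ)) = (As.map (Tm.subst σ)).map (Tm.shift k) := by
  rw [List.map_map, List.map_map]
  congr 1; funext A; exact A.shift_subst_upN k σ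

/-- The mapping `λ*` commutes with the substitutions of a class that is closed under binders and
whose values commute with weakening. It is used for renamings, and then for all substitutions. -/
theorem rel_subst_of {W : (ℕ → Tm C .obj) → Prop} (hup : ∀ σ, W σ → W (up σ))
    (hW : ∀ σ, W σ → ∀ k, rel μ ρ ((σ k).shift 1) = (rel μ ρ (σ k)).shift (n + 1))
    {σ : ℕ → Tm C .obj} (hσ : W σ) (t : Tm C l) :
    rel μ ρ (t.subst σ) = (rel μ ρ t).subst (relSub μ ρ σ) := by
  induction t generalizing σ with
  | cst c => rw [Tm.subst, rel, ρ.closed]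
  | var k => rw [rel, Tm.subst, Tm.subst, relSub_star]
  | app t N iht ihN =>
    rw [Tm.subst, rel, rel, Tm.subst, apps_subst, iht hσ, ihN hσ, copies_subst μ ρ]
  | lam A t ihA iht =>
    have h := lams_subst 0 (copies μ A) (.lam (apps ((rel μ ρ A).shift n) (vars n)) (rel μ ρ t))
      (relSub μ ρ σ)
    rw [Nat.zero_add, copies_length] at h
    refine Eq.trans ?_ h.symm
    rw [Tm.subst, rel, Tm.subst, apps_subst, Tm.shift_subst_upN, vars_subst_upN le_rfl,
      ihA hσ, iht (hup _ hσ), copies_subst μ ρ, relSub_up μ ρ (hW σ hσ)]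
    rfl
  | pi A B ihA ihB =>
    rw [rel_pi]
    have h := lams_subst 0 (copies μ (.pi A B))
      (relProd n ((copies μ A).map (Tm.shift n)) ((rel μ ρ A).shift n)
        ((rel μ ρ B).subst (upN (n + 1) fun j => .var (j + n))) fun i => .var (n - 1 - i))
      (relSub μ ρ σ)
    rw [Nat.zero_add, copies_length] at h
    refine Eq.trans ?_ h.symm
    rw [Tm.subst, rel_pi, relProd_subst (by simp [copies_length]), map_shift_subst_upN,
      Tm.shift_subst_upN, ← copies_subst, ← copies_subst, ihA hσ, ihB (hup _ hσ),
      relSub_up μ ρ (hW σ hσ), Tm.subst_subst, Tm.subst_subst, subst_upN, subst_upN]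
    congr 4
    · funext j
      rw [Tm.subst, upN_add, Tm.shift_eq_subst]
    · funext i
      rw [Tm.subst, upN_of_lt _ (by omega)]

theorem rel_rename (t : Tm C l) (f : ℕ → ℕ) :
    rel μ ρ (t.rename f) = (rel μ ρ t).subst (relSub μ ρ fun i => .var (f i)) := by
  rw [Tm.rename_eq_subst]
  refine rel_subst_of μ ρ (W := fun σ => ∃ f : ℕ → ℕ, σ = fun i => .var (f i)) ?_ ?_ ⟨f, rfl⟩ t
  · rintro _ ⟨f, rfl⟩; exact ⟨_, up_var_comp f⟩
  · rintro _ ⟨f, rfl⟩ k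
    simp only [Tm.shift, Tm.rename, rel]
    congr 1; ring

theorem rel_shift (t : Tm C l) (k : ℕ) :
    rel μ ρ (t.shift k) = (rel μ ρ t).shift (k * (n + 1)) := by
  rw [Tm.shift, rel_rename, Tm.shift_eq_subst]
  congr 1
  refine block_ext n (fun j => ?_) fun j i => ?_
  · rw [relSub_star, rel]; congr 1; ring
  · rw [relSub_copy, copy_var]; congr 1; ring

/-- The mapping `λ*` commutes with substitution. -/
theorem rel_subst (t : Tm C l) (σ : ℕ → Tm C .obj) :
    rel μ ρ (t.subst σ) = (rel μ ρ t).subst (relSub μ ρ σ) :=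
  rel_subst_of μ ρ (W := fun _ => True) (fun _ _ => trivial)
    (fun σ _ k => by rw [rel_shift, Nat.one_mul]) trivial t

theorem relSub_single (N : Tm C .obj) :
    relSub μ ρ (single N) = scons (rel μ ρ N) (instL .var (copies μ N)) := by
  refine block_ext n ?_ ?_
  · rintro (_ | k)
    · rw [relSub_star, Nat.zero_mul]; rfl
    · rw [relSub_star, Nat.succ_mul, ← Nat.add_assoc, scons, copies, instL_ofFn_add]; rfl
  · rintro (_ | k) i
    · rw [relSub_copy, Nat.zero_mul, Nat.zero_add, show n - (i : ℕ) = n - 1 - i + 1 by omega,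
        scons, copies, instL_ofFn]
      rfl
    · rw [relSub_copy, Nat.succ_mul,
        show k * (n + 1) + (n + 1) + (n - (i : ℕ)) = k * (n + 1) + (n - i) + n + 1 by omega,
        scons, copies, instL_ofFn_add]
      rfl

theorem rel_inst (t : Tm C l) (N : Tm C .obj) :
    rel μ ρ (t.inst N) =
      (rel μ ρ t).subst (scons (rel μ ρ N) (instL .var (copies μ N))) := by
  rw [Tm.inst, rel_subst, relSub_single]

theorem relK_subst (K : Kd C) (R : Tm C .ty) (σ : ℕ → Tm C .obj) :
    relK μ ρ (K.subst σ) (R.subst σ) = (relK μ ρ K R).subst (relSub μ ρ σ) := by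
  induction K generalizing R σ with
  | type =>
    have h := pisK_subst 0 (copies μ R) .type (relSub μ ρ σ)
    refine Eq.trans ?_ h.symm
    rw [Kd.subst, relK, copies_subst μ ρ]; rfl
  | pi A K ih =>
    have h := pisK_subst 0 (copies μ A) (.pi (apps ((rel μ ρ A).shift n) (vars n))
      (relK μ ρ K (.app (R.shift 1) (.var 0)))) (relSub μ ρ σ)
    rw [Nat.zero_add, copies_length] at h
    refine Eq.trans ?_ h.symm
    have hup := relSub_up μ ρ (σ := σ) fun k => by rw [rel_shift, Nat.one_mul]
    have hR : Tm.app ((R.subst σ).shift 1) (.var 0) =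
        (Tm.app (R.shift 1) (.var 0)).subst (up σ) := by
      rw [Tm.subst, Tm.shift_subst_up]; rfl
    rw [Kd.subst, relK, Kd.subst, apps_subst, Tm.shift_subst_upN, vars_subst_upN le_rfl,
      copies_subst μ ρ, rel_subst, hR, ih, hup]
    rfl

end RelationSubstitution

section RelationConversion

variable {C : Lvl → Type*} {C' : Lvl → Type*} {l : Lvl} {n : ℕ} {η : Bool} {S : Theory C}
  {T : Theory C'} {μ : Fin n → Params C C'} {ρ : Params C C'}

theorem forall₂_ofFn {α β : Type*} {R : α → β → Prop} {f : Fin n → α} {g : Fin n → β}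
    (h : ∀ i, R (f i) (g i)) : List.Forall₂ R (List.ofFn f) (List.ofFn g) := by
  rw [List.forall₂_iff_get]
  refine ⟨by simp, fun i h₁ h₂ => ?_⟩
  simpa using h ⟨i, by simpa using h₁⟩

theorem forall₂_refl (Ns : List (Tm C l)) : List.Forall₂ (Conv η S) Ns Ns :=
  List.forall₂_same.2 fun _ _ => .refl _

theorem Conv.relProd {As As' : List (Tm C .ty)} (hAs : List.Forall₂ (Conv η S) As As')
    {D D' E E' : Tm C .ty} (hD : Conv η S D D') (hE : Conv η S E E') {F F' : Fin n → Tm C .obj}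
    (hF : ∀ i, Conv η S (F i) (F' i)) :
    Conv η S (relProd n As D E F) (LPR.relProd n As' D' E' F') :=
  .pis hAs 0 (.pi (.apps (hD.shift n) (forall₂_refl _))
    (.apps hE (forall₂_ofFn fun i => .app ((hF i).shift _) (.refl _))))

theorem IsLogicalRelation.copy_conv (h : IsLogicalRelation η S T μ ρ) {t t' : Tm C l}
    (ht : Conv η S t t') (i : Fin n) : Conv η T (copy μ i t) (copy μ i t') :=
  ((h.morphism i).conv ht).rename _

theorem IsLogicalRelation.copies_conv (h : IsLogicalRelation η S T μ ρ) {t t' : Tm C l}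
    (ht : Conv η S t t') : List.Forall₂ (Conv η T) (copies μ t) (copies μ t') :=
  forall₂_ofFn (h.copy_conv ht)

theorem conv_rel_lam_app (A : Tm C .ty) (t : Tm C l) (N : Tm C .obj) :
    Conv η T (rel μ ρ (.app (.lam A t) N)) (rel μ ρ (t.inst N)) := by
  rw [rel_inst, ← Tm.inst_subst_up]
  refine .trans (.app ?_ (.refl _)) (.beta ((apps ((rel μ ρ A).shift n) (vars n)).subst
    (instL .var (copies μ N))) _ _)
  have := Conv.beta_apps (η := η) (T := T) 0 (copies μ A)
    (.lam (apps ((rel μ ρ A).shift n) (vars n)) (rel μ ρ t)) .var (copies μ N)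
    (by rw [copies_length, copies_length])
  rwa [Tm.subst_var] at this

theorem conv_rel_eta (hη : η = true) (A : Tm C .ty) (t : Tm C l) :
    Conv η T (rel μ ρ t) (rel μ ρ (.lam A (.app (t.shift 1) (.var 0)))) := by
  have h := Conv.eta_lams (T := T) hη 0 (copies μ A) (rel μ ρ t)
  rw [copies_length] at h
  refine h.trans (.lams (forall₂_refl _) 0 (.trans (.of_step
    (.eta hη (apps ((rel μ ρ A).shift n) (vars n)) _)) (.of_eq ?_)))
  rw [rel, rel_shift, rel, apps_shift, Tm.shift_shift, Nat.one_mul, Nat.zero_mul]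
  congr 3
  simp only [vars, copies, List.map_ofFn]
  congr 1; funext i
  simp only [Function.comp, Tm.shift, Tm.rename, copy_var]
  congr 1; omega

theorem IsLogicalRelation.rel_conv_step (h : IsLogicalRelation η S T μ ρ) {t t' : Tm C l}
    (ht : Step η S t t') : Conv η T (rel μ ρ t) (rel μ ρ t') := by
  have hc : ∀ {l : Lvl} {t t' : Tm C l}, Step η S t t' →
      List.Forall₂ (Conv η T) (copies μ t) (copies μ t') := fun h' => h.copies_conv (.of_step h')
  induction ht with
  | beta A t N => exact conv_rel_lam_app A t N
  | eta hη A t => exact conv_rel_eta hη A t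
  | rule hr σ => rw [rel_subst, rel_subst]; exact (h.rule _ _ hr).subst _
  | lam_left hA ih =>
    exact .lams (hc hA) 0 (.lam (.apps (ih.shift n) (forall₂_refl _)) (.refl _))
  | lam_right _ ih => exact .lams (forall₂_refl _) 0 (.lam (.refl _) ih)
  | app_left _ ih => exact .app (.apps ih (forall₂_refl _)) (.refl _)
  | app_right hN ih => exact .app (.apps (.refl _) (hc hN)) ih
  | pi_left hA ih =>
    rw [rel_pi, rel_pi]
    refine .lams (hc (.pi_left hA)) 0 (.relProd ?_ (ih.shift n) (.refl _) fun _ => .refl _)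
    simp only [copies, List.map_ofFn]
    exact forall₂_ofFn fun i => (h.copy_conv (.of_step hA) i).shift n
  | pi_right hB ih =>
    rw [rel_pi, rel_pi]
    exact .lams (hc (.pi_right hB)) 0
      (.relProd (forall₂_refl _) (.refl _) (ih.subst _) fun _ => .refl _)

/-- The mapping `λ*` preserves conversion. -/
theorem IsLogicalRelation.rel_conv (h : IsLogicalRelation η S T μ ρ) {t t' : Tm C l}
    (ht : Conv η S t t') : Conv η T (rel μ ρ t) (rel μ ρ t') :=
  eqvGen_map _ (fun _ _ => h.rel_conv_step) ht

theorem IsLogicalRelation.relK_conv_right (h : IsLogicalRelation η S T μ ρ) (K : Kd C)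
    {R R' : Tm C .ty} (hR : Conv η S R R') : ConvK η T (relK μ ρ K R) (relK μ ρ K R') := by
  induction K generalizing R R' with
  | type => exact .pisK (h.copies_conv hR) 0 (.refl _)
  | pi A K ih =>
    exact .pisK (forall₂_refl _) 0 (.pi (.refl _) (ih (.app (hR.shift 1) (.refl _))))

theorem IsLogicalRelation.relK_conv_step (h : IsLogicalRelation η S T μ ρ) {K K' : Kd C}
    (hK : StepK η S K K') (R : Tm C .ty) : ConvK η T (relK μ ρ K R) (relK μ ρ K' R) := by
  induction hK generalizing R with
  | pi_left hA =>
    exact .pisK (h.copies_conv (.of_step hA)) 0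
      (.pi (.apps ((h.rel_conv_step hA).shift n) (forall₂_refl _)) (.refl _))
  | pi_right _ ih => exact .pisK (forall₂_refl _) 0 (.pi (.refl _) (ih _))

theorem IsLogicalRelation.relK_conv (h : IsLogicalRelation η S T μ ρ) {K K' : Kd C}
    (hK : ConvK η S K K') (R : Tm C .ty) : ConvK η T (relK μ ρ K R) (relK μ ρ K' R) :=
  eqvGen_map (fun K => relK μ ρ K R) (fun _ _ hK => h.relK_conv_step hK R) hK

end RelationConversion

/-! ### Translated contexts and the interpretation of products -/

section TranslatedContexts

variable {C : Lvl → Type*} {C' : Lvl → Type*} {n : ℕ} {η : Bool} {S : Theory C}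
  {T : Theory C'} {μ : Fin n → Params C C'} {ρ : Params C C'}

theorem extend_ofFn_getElem (F : Fin n → Tm C .ty) (Γ : Ctx C) (i : Fin n) :
    (extend 0 (List.ofFn F) Γ)[n - 1 - (i : ℕ)]? = some ((F i).shift i) := by
  simpa using extend_getElem 0 (List.ofFn F) Γ i (by simp)

theorem extend_ofFn_getElem_add (F : Fin n → Tm C .ty) (Γ : Ctx C) (j : ℕ) :
    (extend 0 (List.ofFn F) Γ)[j + n]? = Γ[j]? := by
  simpa using extend_getElem_add 0 (List.ofFn F) Γ j

/-- In a translated context, the `i`-th copies of the variables have the types that `μᵢ`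
assigns to them. -/
theorem wfRen_copy (μ : Fin n → Params C C') (ρ : Params C C') (i : Fin n) (Γ : Ctx C) :
    WfRen (fun k => k * (n + 1) + (n - i)) (Γ.map (μ i).tm) (relCtx μ ρ Γ) := by
  induction Γ with
  | nil => exact wfRen_nil _ _
  | cons A Γ ih =>
    rintro (_ | k) B hB
    · obtain rfl : (μ i).tm A = B := by simpa using hB
      refine ⟨(copy μ i A).shift i, ?_, ?_⟩
      · beta_reduce
        rw [relCtx, show 0 * (n + 1) + (n - (i : ℕ)) = n - 1 - i + 1 by omega,
          List.getElem?_cons_succ]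
        exact extend_ofFn_getElem _ _ i
      · simp only [copy, Tm.shift, Tm.rename_rename]
        congr 1; funext j
        have := i.2
        simp only [Nat.add_mul, Nat.one_mul, Nat.zero_mul]
        omega
    · obtain ⟨D, hD, hDB⟩ := ih k B (by simpa using hB)
      have e : (k + 1) * (n + 1) + (n - (i : ℕ)) = k * (n + 1) + (n - i) + n + 1 := by
        rw [Nat.add_mul]; omega
      refine ⟨D, ?_, ?_⟩
      · beta_reduce
        rw [relCtx, e, List.getElem?_cons_succ]
        exact (extend_ofFn_getElem_add _ _ _).trans hD
      · beta_reduce at hDB ⊢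
        rw [e, show k * (n + 1) + (n - (i : ℕ)) + n + 1 + 1 =
          k * (n + 1) + (n - (i : ℕ)) + 1 + (n + 1) by omega, ← Tm.shift_shift, hDB]
        simp only [Tm.shift, Tm.rename_rename]
        congr 1; funext j; ring

theorem relCtx_getElem_star (μ : Fin n → Params C C') (ρ : Params C C') {Γ : Ctx C} {k : ℕ}
    {A : Tm C .ty} (hA : Γ[k]? = some A) :
    (relCtx μ ρ Γ)[k * (n + 1)]? = some (apps ((rel μ ρ A).shift n) (vars n)) := by
  induction Γ generalizing k with
  | nil => simp at hA
  | cons B Γ ih =>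
    rcases k with _ | k
    · obtain rfl : B = A := by simpa using hA
      simp [relCtx]
    · rw [relCtx, Nat.succ_mul, ← Nat.add_assoc, List.getElem?_cons_succ]
      exact (extend_ofFn_getElem_add _ _ _).trans (ih (by simpa using hA))

namespace IsLogicalRelation

theorem copy_hasType (h : IsLogicalRelation η S T μ ρ) (hT : T.Wf η) {Γ : Ctx C}
    {M : Tm C .obj} {A : Tm C .ty} (hM : HasType η S Γ M A)
    (hΓ : WfCtx η T (relCtx μ ρ Γ)) (i : Fin n) :
    HasType η T (relCtx μ ρ Γ) (copy μ i M) (copy μ i A) :=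
  HasType.rename hT ((h.morphism i).derives hT hM) (wfRen_copy μ ρ i Γ) hΓ

theorem copies_hasType (h : IsLogicalRelation η S T μ ρ) (hT : T.Wf η) {Γ : Ctx C}
    {M : Tm C .obj} {A : Tm C .ty} (hM : HasType η S Γ M A) (hΓ : WfCtx η T (relCtx μ ρ Γ)) :
    List.Forall₂ (HasType η T (relCtx μ ρ Γ)) (copies μ M) (copies μ A) :=
  forall₂_ofFn (h.copy_hasType hT hM hΓ)

theorem copies_hasKind (h : IsLogicalRelation η S T μ ρ) (hT : T.Wf η) {Γ : Ctx C}
    {A : Tm C .ty} (hA : HasKind η S Γ A .type) (hΓ : WfCtx η T (relCtx μ ρ Γ)) :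
    ∀ A' ∈ copies μ A, HasKind η T (relCtx μ ρ Γ) (A'.shift 0) .type := by
  intro A' hA'
  obtain ⟨i, rfl⟩ := (List.mem_ofFn' _ _).1 hA'
  rw [Tm.shift_zero]
  exact HasKind.rename hT ((h.morphism i).derives hT hA) (wfRen_copy μ ρ i Γ) hΓ

end IsLogicalRelation

end TranslatedContexts

section RelationTyping

variable {C : Lvl → Type*} {C' : Lvl → Type*} {n : ℕ} {η : Bool} {S : Theory C}
  {T : Theory C'} {μ : Fin n → Params C C'} {ρ : Params C C'}

theorem pisK_type_subst (As : List (Tm C .ty)) (σ : ℕ → Tm C .obj) :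
    (pisK 0 As .type).subst σ = pisK 0 (As.map (Tm.subst σ)) .type :=
  pisK_subst 0 As .type σ

theorem wfSub_shift {Γ Δ : Ctx C} {k : ℕ} (hr : WfRen (· + k) Γ Δ) (hΔ : WfCtx η S Δ) :
    WfSub η S (fun j => .var (j + k)) Γ Δ := fun i A hA => by
  obtain ⟨B, hB, hBA⟩ := hr i A hA
  rw [← Tm.rename_eq_subst, ← hBA]
  exact .var hB hΔ

theorem map_subst_shift (As : List (Tm C .ty)) (k : ℕ) :
    As.map (Tm.subst fun j => .var (j + k)) = As.map (Tm.shift k) := by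
  congr 1; funext A; exact (A.shift_eq_subst k).symm

theorem wfSub_extend {As : List (Tm C .ty)} (hAs : As.length = n) {Γ : Ctx C}
    (hΓ : WfCtx η S (extend 0 As Γ)) :
    WfSub η S (fun j => .var (j + n)) Γ (extend 0 As Γ) := by
  subst hAs; exact wfSub_shift (wfRen_extend 0 As Γ) hΓ

/-- The variables of a block have the types of the block. -/
theorem vars_hasType {F : Fin n → Tm C .ty} {Γ : Ctx C}
    (hΓ : WfCtx η S (extend 0 (List.ofFn F) Γ)) (i : Fin n) :
    HasType η S (extend 0 (List.ofFn F) Γ) (.var (n - 1 - i)) ((F i).shift n) := by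
  have := HasType.extend_var hΓ i (by simp)
  simpa using this

/-- The type `D x₁ … xₙ` of `x*` is well formed if `D` is a relation on the types of the `xᵢ`. -/
theorem hasKind_star (hS : S.Wf η) {F : Fin n → Tm C .ty} {Γ : Ctx C} {D : Tm C .ty}
    (hF : ∀ A ∈ List.ofFn F, HasKind η S Γ (A.shift 0) .type)
    (hD : HasKind η S Γ D (pisK 0 (List.ofFn F) .type)) :
    HasKind η S (extend 0 (List.ofFn F) Γ) (apps (D.shift n) (vars n)) .type := by
  have hΓ := WfCtx.extend hS hD.wfCtx hF
  have h := HasKind.subst hS hD (wfSub_extend (n := n) (by simp) hΓ) hΓ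
  rw [pisK_type_subst, map_subst_shift, ← Tm.shift_eq_subst, List.map_ofFn] at h
  refine HasKind.apps (τ := .var) (k := 0) (K := .type) (fun _ => rfl)
    (by rwa [Kd.subst_var]) (forall₂_ofFn (vars_hasType hΓ))

theorem star_subst (D : Tm C .ty) (F : Fin n → Tm C .obj) :
    (apps (D.shift n) (vars n)).subst (instL .var (List.ofFn F)) = apps D (List.ofFn F) := by
  rw [apps_subst, vars_subst_instL, shift_subst_eq (instL_ofFn_add _ F)]

theorem hasKind_relProd (hS : S.Wf η) {F : Fin n → Tm C .ty} {Γ : Ctx C} {D E : Tm C .ty}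
    {G : Fin n → Tm C .obj} (hF : ∀ A ∈ List.ofFn F, HasKind η S Γ (A.shift 0) .type)
    (hD : HasKind η S Γ D (pisK 0 (List.ofFn F) .type))
    (hE : HasKind η S (apps (D.shift n) (vars n) :: extend 0 (List.ofFn F) Γ)
      (apps E (List.ofFn fun i : Fin n => .app ((G i).shift (n + 1)) (.var (n - i)))) .type) :
    HasKind η S Γ (relProd n (List.ofFn F) D E G) .type :=
  .pis hS hF (.prod_type (hasKind_star hS hF hD) hE)

/-- Typing of the application of a copied function, over any context into which the source
variables are mapped by `θ`, and those of the body by `ξ`. -/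
theorem copy_pi_app (i : Fin n) {Δ : Ctx C'} {A B : Tm C .ty} {f a : Tm C' .obj}
    {θ ξ : ℕ → Tm C' .obj} (hf : HasType η T Δ f ((copy μ i (.pi A B)).subst θ))
    (ha : HasType η T Δ a ((copy μ i A).subst θ)) (h₀ : ξ (n - i) = a)
    (h₁ : ∀ k, ξ (k + (n + 1)) = θ k) :
    HasType η T Δ (.app f a) ((copy μ i B).subst ξ) := by
  have := Derives.app_obj hf ha
  rw [Tm.inst_subst_up, Tm.subst_rename] at this
  rw [copy, Tm.subst_rename]
  convert this using 3 with j
  rcases j with _ | j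
  · rw [Nat.zero_mul, Nat.zero_add]; exact h₀
  · rw [Nat.add_mul, Nat.one_mul, Nat.add_right_comm]; exact h₁ _

/-- Beta-reduction of the application of a copied abstraction, similarly. -/
theorem copy_lam_app (i : Fin n) (A : Tm C .ty) (M : Tm C .obj) (a : Tm C' .obj)
    {θ ξ : ℕ → Tm C' .obj} (h₀ : ξ (n - i) = a) (h₁ : ∀ k, ξ (k + (n + 1)) = θ k) :
    Conv η T (.app ((copy μ i (.lam A M)).subst θ) a) ((copy μ i M).subst ξ) := by
  refine (Conv.beta ((copy μ i A).subst θ) _ a).trans (.of_eq ?_)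
  rw [Tm.inst_subst_up, Tm.subst_rename, copy, Tm.subst_rename]
  congr 1; funext j
  rcases j with _ | j
  · rw [Nat.zero_mul, Nat.zero_add]; exact h₀.symm
  · rw [Nat.add_mul, Nat.one_mul, Nat.add_right_comm]; exact (h₁ _).symm

theorem relProd_subst_instL (A B : Tm C .ty) (F : Fin n → Tm C' .obj) :
    (relProd n ((copies μ A).map (Tm.shift n)) ((rel μ ρ A).shift n)
        ((rel μ ρ B).subst (upN (n + 1) fun j => .var (j + n)))
        fun i => .var (n - 1 - i)).subst (instL .var (List.ofFn F)) =
      relProd n (copies μ A) (rel μ ρ A) (rel μ ρ B) F := by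
  have hF := instL_ofFn_add (C := C') .var F
  rw [relProd_subst (by simp [copies_length]), shift_subst_eq hF, Tm.subst_subst, subst_upN,
    List.map_map]
  congr 1
  · exact (List.map_congr_left fun A _ => shift_subst_eq hF A).trans (List.map_id _)
  · simp only [Tm.subst, hF, upN_var, Tm.subst_var]
  · funext i; exact instL_ofFn _ F i

/-- The interpretation of a product relates `F₁, …, Fₙ` if these map related arguments to
related results. -/
theorem conv_rel_pi (A B : Tm C .ty) (F : Fin n → Tm C' .obj) :
    Conv η T (apps (rel μ ρ (.pi A B)) (List.ofFn F))
      (relProd n (copies μ A) (rel μ ρ A) (rel μ ρ B) F) := by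
  rw [rel_pi, ← relProd_subst_instL]
  have h := Conv.beta_apps (η := η) (T := T) 0 (copies μ (.pi A B))
    (relProd n ((copies μ A).map (Tm.shift n)) ((rel μ ρ A).shift n)
        ((rel μ ρ B).subst (upN (n + 1) fun j => .var (j + n)))
        fun i => .var (n - 1 - i)) .var (List.ofFn F) (by simp [copies_length])
  rwa [Tm.subst_var] at h

/-- The type that the translation of `λ x : A. M` has by the typing rules is convertible to the
one that the abstraction theorem assigns to it. -/
theorem conv_rel_pi_lam (A B : Tm C .ty) (M : Tm C .obj) :
    Conv η T (pis 0 (copies μ A) (.pi (apps ((rel μ ρ A).shift n) (vars n))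
        (apps (rel μ ρ B) (copies μ M))))
      (apps (rel μ ρ (.pi A B)) (copies μ (.lam A M))) := by
  refine .symm ((conv_rel_pi A B _).trans ?_)
  refine .pis (forall₂_refl _) 0 (.pi (.refl _) (.apps (.refl _) (forall₂_ofFn fun i => ?_)))
  have := copy_lam_app (η := η) (T := T) (μ := μ) i A M (.var (n - i)) (ξ := .var)
    (θ := fun k => .var (k + (n + 1))) rfl fun _ => rfl
  rwa [← Tm.shift_eq_subst, Tm.subst_var] at this

theorem rel_var_type (A : Tm C .ty) (k : ℕ) :
    (apps ((rel μ ρ A).shift n) (vars n)).shift (k * (n + 1) + 1) =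
      apps (rel μ ρ (A.shift (k + 1))) (copies μ (.var k)) := by
  rw [apps_shift, rel_shift, Tm.shift_shift,
    show n + (k * (n + 1) + 1) = (k + 1) * (n + 1) by ring]
  congr 1
  simp only [vars, copies, List.map_ofFn]
  congr 1; funext i
  simp only [Function.comp, Tm.shift, Tm.rename, copy_var]
  congr 1; omega

end RelationTyping

/-! ### The abstraction theorem -/

section Abstraction

variable {C : Lvl → Type*} {C' : Lvl → Type*} {n : ℕ} {η : Bool} {S : Theory C}
  {T : Theory C'} {μ : Fin n → Params C C'} {ρ : Params C C'}

/-- The source type `R x` at which the kind `K` is interpreted in the clause for `Π x : A. K` has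
kind `K`. -/
theorem HasKind.eta_app (hS : S.Wf η) {Γ : Ctx C} {A R : Tm C .ty} {K : Kd C}
    (hR : HasKind η S Γ R (.pi A K)) (hA : HasKind η S Γ A .type) :
    HasKind η S (A :: Γ) (.app (R.shift 1) (.var 0)) K := by
  have h : HasKind η S (A :: Γ) (R.shift 1)
      (.pi (A.shift 1) (K.subst (up fun i => .var (i + 1)))) := by
    rw [Tm.shift_eq_subst A]
    exact HasKind.rename hS hR (wfRen_shift_one Γ A) hA.wfCtx_cons
  have := Derives.app_type h (.var (i := 0) rfl hA.wfCtx_cons)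
  rw [Kd.inst_subst_up] at this
  convert this using 2
  refine K.subst_var.symm.trans (congrArg (Kd.subst · K) ?_)
  funext i; cases i <;> rfl

namespace IsLogicalRelation

theorem rel_apps_hasKind (h : IsLogicalRelation η S T μ ρ) (hT : T.Wf η) {Γ : Ctx C}
    {A : Tm C .ty} {M : Tm C .obj}
    (hA : HasKind η T (relCtx μ ρ Γ) (rel μ ρ A) (relK μ ρ .type A)) (hM : HasType η S Γ M A) :
    HasKind η T (relCtx μ ρ Γ) (apps (rel μ ρ A) (copies μ M)) .type := by
  refine HasKind.apps (τ := .var) (k := 0) (K := .type) (fun _ => rfl) ?_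
    (h.copies_hasType hT hM hA.wfCtx)
  rw [Kd.subst_var]
  exact hA

theorem rel_pi_hasKind (h : IsLogicalRelation η S T μ ρ) (hT : T.Wf η) {Γ : Ctx C}
    {A B : Tm C .ty} (hA : HasKind η S Γ A .type) (hB : HasKind η S (A :: Γ) B .type)
    (ihA : HasKind η T (relCtx μ ρ Γ) (rel μ ρ A) (relK μ ρ .type A))
    (ihB : HasKind η T (relCtx μ ρ (A :: Γ)) (rel μ ρ B) (relK μ ρ .type B)) :
    HasKind η T (relCtx μ ρ Γ) (rel μ ρ (.pi A B)) (relK μ ρ .type (.pi A B)) := by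
  have hΓ := ihA.wfCtx
  have hpi := h.copies_hasKind hT (.prod_type hA hB) hΓ
  -- `Γ₁` extends the translated context by `f₁, …, fₙ`
  set Γ₁ := extend 0 (copies μ (.pi A B)) (relCtx μ ρ Γ)
  have wf₁ : WfCtx η T Γ₁ := WfCtx.extend hT hΓ hpi
  have hs : WfSub η T (fun j => .var (j + n)) (relCtx μ ρ Γ) Γ₁ :=
    wfSub_extend (copies_length μ _) wf₁
  rw [rel_pi]
  refine HasKind.lams hT hpi (.sort wf₁) ?_
  have hmap : (copies μ A).map (Tm.shift n) = List.ofFn fun i => (copy μ i A).shift n := by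
    rw [copies, List.map_ofFn]; rfl
  have hF : ∀ A' ∈ List.ofFn (fun i => (copy μ i A).shift n),
      HasKind η T Γ₁ (A'.shift 0) .type := by
    intro A' hA'
    obtain ⟨i, rfl⟩ := (List.mem_ofFn' _ _).1 hA'
    have := h.copies_hasKind hT hA hΓ (copy μ i A) (List.mem_ofFn.2 ⟨i, rfl⟩)
    rw [Tm.shift_zero] at this ⊢
    beta_reduce
    rw [Tm.shift_eq_subst]
    exact HasKind.subst hT this hs wf₁
  have hD : HasKind η T Γ₁ ((rel μ ρ A).shift n)
      (pisK 0 (List.ofFn fun i => (copy μ i A).shift n) .type) := by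
    have := HasKind.subst hT ihA hs wf₁
    rwa [relK, pisK_type_subst, map_subst_shift, ← Tm.shift_eq_subst, hmap] at this
  rw [hmap]
  refine hasKind_relProd hT hF hD ?_
  -- `Γ₃` extends `Γ₁` further by `x₁, …, xₙ, x*`
  have hstar := hasKind_star hT hF hD
  set Γ₂ := extend 0 (List.ofFn fun i => (copy μ i A).shift n) Γ₁
  set X := apps (((rel μ ρ A).shift n).shift n) (vars n)
  have wf₃ : WfCtx η T (X :: Γ₂) := hstar.wfCtx_cons
  have hs₃ : WfSub η T (upN (n + 1) fun j => .var (j + n)) (relCtx μ ρ (A :: Γ)) (X :: Γ₂) := by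
    have h₂ := WfSub.upN (k := 0) (As := copies μ A) hT hs
      (by rw [map_subst_shift, hmap]; exact hF)
    rw [map_subst_shift, hmap, copies_length, Nat.zero_add] at h₂
    have hX' : (apps ((rel μ ρ A).shift n) (vars n)).subst
        (upN n fun j => .var (j + n)) = X := by
      rw [apps_subst, Tm.shift_subst_upN, vars_subst_upN le_rfl, ← Tm.shift_eq_subst]
    have := h₂.up hT (A := apps ((rel μ ρ A).shift n) (vars n)) (by rw [hX']; exact wf₃)
    rwa [hX'] at this
  have hB' := HasKind.subst hT ihB hs₃ wf₃
  rw [relK, pisK_type_subst] at hB'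
  refine HasKind.apps (τ := .var) (k := 0) (K := .type) (fun _ => rfl)
    (by rw [Kd.subst_var]; exact hB') ?_
  rw [copies, List.map_ofFn]
  refine forall₂_ofFn fun i => ?_
  -- the weakening from `Γ₁` to `Γ₃`
  have hr : WfRen (fun j => j + n + 1) Γ₁ (X :: Γ₂) := by
    refine WfRen.comp (wfRen_shift_one Γ₂ X) ?_
    have := wfRen_extend 0 (List.ofFn fun i => (copy μ i A).shift n) Γ₁
    rwa [List.length_ofFn] at this
  refine copy_pi_app (A := A) (θ := fun k => .var (k + (n + (n + 1)))) i ?_ ?_ ?_ ?_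
  · have := HasType.rename hT (vars_hasType (F := fun i => copy μ i (.pi A B)) wf₁ i) hr wf₃
    change HasType η T _ (((Tm.var (n - 1 - i)).shift (n + 1)))
      (((copy μ i (.pi A B)).shift n).shift (n + 1)) at this
    rwa [Tm.shift_shift, Tm.shift_eq_subst (copy μ i _)] at this
  · have := HasType.rename hT (vars_hasType (F := fun i => (copy μ i A).shift n) hstar.wfCtx i)
      (wfRen_shift_one Γ₂ X) wf₃
    change HasType η T _ (.var (n - 1 - i + 1)) ((((copy μ i A).shift n).shift n).shift 1) at this
    rwa [Tm.shift_shift, Tm.shift_shift, Tm.shift_eq_subst (copy μ i _),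
      show n - 1 - (i : ℕ) + 1 = n - i by omega] at this
  · exact upN_of_lt _ (by omega)
  · intro k
    rw [upN_add]
    simp only [Tm.shift, Tm.rename, Nat.add_assoc]

/-- The case of applications. The type of `λ*(M)` is converted to a product; that this product is
well formed is read off, by inversion and substitution, from a derivation for the type of `λ*(M)`,
since products are not known to be injective. -/
theorem rel_app_obj (h : IsLogicalRelation η S T μ ρ) (hT : T.Wf η) {Γ : Ctx C}
    {A B : Tm C .ty} {M N : Tm C .obj} (hM : HasType η S Γ M (.pi A B)) (hN : HasType η S Γ N A)
    (ihM : HasType η T (relCtx μ ρ Γ) (rel μ ρ M) (apps (rel μ ρ (.pi A B)) (copies μ M)))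
    (ihN : HasType η T (relCtx μ ρ Γ) (rel μ ρ N) (apps (rel μ ρ A) (copies μ N))) :
    HasType η T (relCtx μ ρ Γ) (rel μ ρ (.app M N))
      (apps (rel μ ρ (B.inst N)) (copies μ (.app M N))) := by
  have hΓ := ihM.wfCtx
  have hprod : HasKind η T (relCtx μ ρ Γ)
      (relProd n (copies μ A) (rel μ ρ A) (rel μ ρ B) fun i => copy μ i M) .type := by
    obtain ⟨_, h₁⟩ := HasKind.apps_inv (HasType.hasKind hT ihM)
    rw [rel_pi] at h₁
    obtain ⟨_, h₂⟩ := HasKind.lams_inv h₁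
    have h₃ := HasKind.subst hT (HasKind.pis_pi_type h₂) (WfSub.instL (k := 0) (τ := .var)
      (fun _ => rfl) (wfSub_var hΓ) (h.copies_hasType hT hM hΓ)) hΓ
    rw [← relProd_subst_instL]
    exact h₃
  have hM' := Derives.conv_type (conv_rel_pi A B _) ihM hprod
  rw [relProd] at hM'
  have h₁ := HasType.apps (k := 0) (τ := .var) (fun _ => rfl)
    (by rw [Tm.subst_var]; exact hM') (h.copies_hasType hT hN hΓ)
  rw [Tm.subst, copies, star_subst] at h₁
  have h₂ := Derives.app_obj h₁ ihN
  rw [Tm.inst_subst_up, apps_subst, ← copies, ← relSub_single, ← rel_subst, List.map_ofFn] at h₂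
  have e : (List.ofFn (Tm.subst (relSub μ ρ (single N)) ∘
      fun i : Fin n => .app ((copy μ i M).shift (n + 1)) (.var (n - i)))) =
      copies μ (.app M N) := by
    rw [copies]
    congr 1; funext i
    simp only [Function.comp, Tm.subst]
    change _ = Tm.app (copy μ i M) (copy μ i N)
    congr 1
    · rw [Tm.subst_shift, relSub_single]
      exact ((copy μ i M).subst_congr fun j => instL_ofFn_add _ _ j).trans (Tm.subst_var _)
    · have := relSub_copy μ ρ (single N) 0 i
      rwa [Nat.zero_mul, Nat.zero_add] at this
  rw [e] at h₂
  exact h₂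

theorem rel_app_type (h : IsLogicalRelation η S T μ ρ) (hT : T.Wf η) {Γ : Ctx C}
    {A B : Tm C .ty} {K : Kd C} {M : Tm C .obj} (hM : HasType η S Γ M B)
    (ihA : HasKind η T (relCtx μ ρ Γ) (rel μ ρ A) (relK μ ρ (.pi B K) A))
    (ihM : HasType η T (relCtx μ ρ Γ) (rel μ ρ M) (apps (rel μ ρ B) (copies μ M))) :
    HasKind η T (relCtx μ ρ Γ) (rel μ ρ (.app A M)) (relK μ ρ (K.inst M) (.app A M)) := by
  rw [relK] at ihA
  have h₁ := HasKind.apps (k := 0) (τ := .var) (fun _ => rfl)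
    (by rw [Kd.subst_var]; exact ihA) (h.copies_hasType hT hM ihM.wfCtx)
  rw [Kd.subst, copies, star_subst] at h₁
  have h₂ := Derives.app_type h₁ ihM
  rw [Kd.inst_subst_up, ← copies, ← relSub_single, ← relK_subst,
    show (Tm.app (A.shift 1) (.var 0)).subst (single M) = .app A M from
      congrArg (Tm.app · M) (Tm.inst_shift A M)] at h₂
  exact h₂

theorem relK_type_wfKind (h : IsLogicalRelation η S T μ ρ) (hT : T.Wf η) {Γ : Ctx C}
    {A : Tm C .ty} (hA : HasKind η S Γ A .type) (hΓ : WfCtx η T (relCtx μ ρ Γ)) :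
    WfKind η T (relCtx μ ρ Γ) (relK μ ρ .type A) :=
  .pisK hT (h.copies_hasKind hT hA hΓ) (.sort (WfCtx.extend hT hΓ (h.copies_hasKind hT hA hΓ)))

theorem star_hasKind (h : IsLogicalRelation η S T μ ρ) (hT : T.Wf η) {Γ : Ctx C}
    {A : Tm C .ty} (hA : HasKind η S Γ A .type)
    (ihA : HasKind η T (relCtx μ ρ Γ) (rel μ ρ A) (relK μ ρ .type A)) :
    HasKind η T (extend 0 (copies μ A) (relCtx μ ρ Γ)) (apps ((rel μ ρ A).shift n) (vars n))
      .type :=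
  hasKind_star hT (h.copies_hasKind hT hA ihA.wfCtx) ihA

theorem relK_pi_wfKind (h : IsLogicalRelation η S T μ ρ) (hS : S.Wf η) (hT : T.Wf η) {Γ : Ctx C}
    {A R : Tm C .ty} {K : Kd C} (hA : HasKind η S Γ A .type) (hR : HasKind η S Γ R (.pi A K))
    (ihA : HasKind η T (relCtx μ ρ Γ) (rel μ ρ A) (relK μ ρ .type A))
    (ihK : ∀ B, HasKind η S (A :: Γ) B K → WfKind η T (relCtx μ ρ (A :: Γ)) (relK μ ρ K B)) :
    WfKind η T (relCtx μ ρ Γ) (relK μ ρ (.pi A K) R) :=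
  .pisK hT (h.copies_hasKind hT hA ihA.wfCtx)
    (.prod_kind (h.star_hasKind hT hA ihA) (ihK _ (hR.eta_app hS hA)))

end IsLogicalRelation

/-- The statement that the translation of a judgment of `S` holds in `T`. For a kind `K`, which
`λ*` interprets relative to a type, it refers to all source types of kind `K`. -/
def Judg.Abstraction (η : Bool) (S : Theory C) (T : Theory C') (μ : Fin n → Params C C')
    (ρ : Params C C') : Judg C → Prop
  | .ctx Γ => WfCtx η T (relCtx μ ρ Γ)
  | .obj Γ M A => HasType η T (relCtx μ ρ Γ) (rel μ ρ M) (apps (rel μ ρ A) (copies μ M))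
  | .ty Γ A K => HasKind η T (relCtx μ ρ Γ) (rel μ ρ A) (relK μ ρ K A)
  | .kind Γ K => WfCtx η T (relCtx μ ρ Γ) ∧
      ∀ A, HasKind η S Γ A K → WfKind η T (relCtx μ ρ Γ) (relK μ ρ K A)

theorem IsLogicalRelation.abstraction (h : IsLogicalRelation η S T μ ρ) (hS : S.Wf η)
    (hT : T.Wf η) {J : Judg C} (hJ : Derives η S J) : J.Abstraction η S T μ ρ := by
  induction hJ with
  | empty => exact .empty
  | decl _ hA _ ihA => exact (h.star_hasKind hT hA ihA).wfCtx_cons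
  | const_obj hc _ ih =>
    have := HasType.of_nil hT (h.obj _ _ hc) ih
    exact this
  | @var Γ i A hA _ ih =>
    have := Derives.var (relCtx_getElem_star μ ρ hA) ih
    rwa [rel_var_type] at this
  | abs_obj hA hB hM ihA ihB ihM =>
    have hpi := h.rel_pi_hasKind hT hA hB ihA ihB
    have hlam : HasType η S _ _ _ := .abs_obj hA hB hM
    refine .conv_type (conv_rel_pi_lam _ _ _) ?_ (h.rel_apps_hasKind hT hpi hlam)
    exact HasType.lams hT (h.copies_hasKind hT hA ihA.wfCtx)
      (.abs_obj (h.star_hasKind hT hA ihA) (HasType.hasKind hT ihM) ihM)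
  | app_obj hM hN ihM ihN => exact h.rel_app_obj hT hM hN ihM ihN
  | conv_type hc hM hB ihM ihB =>
    refine .conv_type (.apps (h.rel_conv hc) (forall₂_refl _)) ihM
      (h.rel_apps_hasKind hT ihB ?_)
    exact .conv_type hc hM hB
  | const_type hc _ ih => exact HasKind.of_nil hT (h.ty _ _ hc) ih
  | prod_type hA hB ihA ihB => exact h.rel_pi_hasKind hT hA hB ihA ihB
  | @abs_type Γ A B K hA hK hB ihA ihK ihB =>
    have hlam : HasKind η S Γ (.lam A B) (.pi A K) := .abs_type hA hK hB
    have hdom := h.star_hasKind hT hA ihA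
    have hwf := h.copies_hasKind hT hA (HasKind.wfCtx ihA)
    have hkB := ihK.2 B hB
    refine .conv_kind ?_ (HasKind.lams hT hwf (.prod_kind hdom hkB) (.abs_type hdom hkB ihB))
      (h.relK_pi_wfKind hS hT hA hlam ihA ihK.2)
    refine .pisK (forall₂_refl _) 0 (.pi (.refl _) (h.relK_conv_right K (.symm ?_)))
    refine (Conv.beta (A.shift 1) _ (.var 0)).trans (.of_eq ?_)
    rw [Tm.inst, Tm.subst_rename]
    refine (B.subst_congr fun i => ?_).trans B.subst_var
    cases i <;> rfl
  | app_type _ hM ihA ihM => exact h.rel_app_type hT hM ihA ihM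
  | conv_kind hc hA hK ihA ihK =>
    exact .conv_kind (h.relK_conv hc _) ihA (ihK.2 _ (.conv_kind hc hA hK))
  | sort _ ih => exact ⟨ih, fun A hA => h.relK_type_wfKind hT hA ih⟩
  | prod_kind hA _ ihA ihK =>
    exact ⟨HasKind.wfCtx ihA, fun R hR => h.relK_pi_wfKind hS hT hA hR ihA ihK.2⟩

end Abstraction

end LPR

theorem theorem2 {C : LPR.Lvl → Type*} {C' : LPR.Lvl → Type*} (η : Bool)
    (S : LPR.Theory C) (T : LPR.Theory C')
    (hS : LPR.Theory.Wf η S) (hT : LPR.Theory.Wf η T)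
    (n : ℕ) (μ : Fin n → LPR.Params C C') (ρ : LPR.Params C C')
    (hρ : LPR.IsLogicalRelation η S T μ ρ) :
    (∀ Γ : LPR.Ctx C, LPR.WfCtx η S Γ → LPR.WfCtx η T (LPR.relCtx μ ρ Γ)) ∧
    (∀ (Γ : LPR.Ctx C) (M : LPR.Tm C .obj) (A : LPR.Tm C .ty),
      LPR.HasType η S Γ M A → LPR.HasKind η S Γ A .type →
      LPR.HasType η T (LPR.relCtx μ ρ Γ) (LPR.rel μ ρ M)
        (LPR.apps (LPR.rel μ ρ A) (LPR.copies μ M))) ∧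
    (∀ (Γ : LPR.Ctx C) (A : LPR.Tm C .ty) (K : LPR.Kd C),
      LPR.HasKind η S Γ A K → LPR.WfKind η S Γ K →
      LPR.HasKind η T (LPR.relCtx μ ρ Γ) (LPR.rel μ ρ A) (LPR.relK μ ρ K A)) ∧
    (∀ (Γ : LPR.Ctx C) (K : LPR.Kd C) (A : LPR.Tm C .ty),
      LPR.WfKind η S Γ K → LPR.HasKind η S Γ A K →
      LPR.WfKind η T (LPR.relCtx μ ρ Γ) (LPR.relK μ ρ K A)) := by
  have key : ∀ {J : LPR.Judg C}, LPR.Derives η S J → J.Abstraction η S T μ ρ := fun hJ =>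
    hρ.abstraction hS hT hJ
  refine ⟨fun Γ hΓ => key hΓ, fun Γ M A hM _ => key hM, fun Γ A K hA _ => key hA,
    fun Γ K A hK hA => (key hK).2 A hA⟩
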